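/- Let $\beta>0$. For each $n\ge 1$ let $G_n=(G_{n,ij})_{i,j\le n}$ have i.i.d. $\mathsf N(0,1)$ entries (with an arbitrary joint distribution of $G_1,G_2,\dots$ for different $n$), let $W_n=(G_n+G_n^{\mathsf T})/\sqrt{2n}$, and let $$Z_n(\beta)=\sum_{\sigma\in\{+1,-1\}^n}\exp\Big\{\frac{\beta}{2}\langle \sigma,W_n\sigma\rangle\Big\}$$ be the partition function of the Sherrington–Kirkpatrick model (the case $\lambda=0$, without external field). For an integer $k\ge 0$ and parameters $\mathbf q=(q_0,\dots,q_k)$, $\mathbf m=(m_0,\dots,m_{k-1})$ with $0\le q_0\le q_1\le\dots\le q_k\le 1$ and $0\le m_0\le\dots\le m_{k-1}\le 1$, put $m_{-1}=0$, $m_k=1$, let $g_0,\dots,g_k$ be i.i.d. $\mathsf N(0,1)$, and define $$\mathcal Z_k=2\cosh\Big[\beta\Big(\sqrt{q_0}\,g_0+\sum_{i=1}^k\sqrt{q_i-q_{i-1}}\,g_i\Big)\Big],\qquad \mathcal Z_{i-1}=\Big(\mathbb E\big[\mathcal Z_i^{\,m_{i-1}}\,\big|\,g_0,\dots,g_{i-1}\big]\Big)^{1/m_{i-1}}\quad(1\le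 i\le k),$$ where for $m_{i-1}=0$ the right-hand side is understood as its limit $\exp\mathbb E[\log\mathcal Z_i\,|\,g_0,\dots,g_{i-1}]$. The $k$-step replica symmetry breaking free energy functional is $$\Psi_{k\mathrm{RSB}}(\mathbf q,\mathbf m)=\frac{\beta^2}{4}(1-2q_k)+\frac{\beta^2}{4}\sum_{l=0}^k(m_l-m_{l-1})q_l^2+\mathbb E\log\mathcal Z_0 .$$ **Theorem (replica symmetry breaking upper bound).** There is a deterministic constant $\phi=\phi(\beta)\in\mathbb R$ such that, almost surely, $\lim_{n\to\infty}\frac1n\log Z_n(\beta)=\phi$, and $$\phi\;\le\;\inf_{k,\mathbf q,\mathbf m}\Psi_{k\mathrm{RSB}}(\mathbf q,\mathbf m),$$ where the infimum is over all integers $k\ge0$ and all $\mathbf q,\mathbf m$ as above. -/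

import Mathlib

open MeasureTheory ProbabilityTheory Filter Topology

universe u

namespace SK

/-- The symmetric matrix `W = (G + Gᵀ) / √(2n)`; it is a `GOE(n)` matrix when the entries of `G` are
i.i.d. standard Gaussian. -/
noncomputable def goe {n : ℕ} (G : Matrix (Fin n) (Fin n) ℝ) : Matrix (Fin n) (Fin n) ℝ :=
  (Real.sqrt (2 * (n : ℝ)))⁻¹ • (G + G.transpose)

/-- The partition function `∑_{σ ∈ {±1}ⁿ} exp ((β / 2) ⟨W, σ σᵀ⟩)` (no signal, no external field).
The units of `ℤ` are the two spin values `1` and `-1`. -/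
noncomputable def partition {n : ℕ} (β : ℝ) (W : Matrix (Fin n) (Fin n) ℝ) : ℝ :=
  ∑ σ : Fin n → ℤˣ,
    Real.exp (β / 2 * ∑ i, ∑ j, W i j * (((σ i : ℤ) : ℝ) * ((σ j : ℤ) : ℝ)))

/-- Parameters of `k`-step replica symmetry breaking: `0 ≤ q₀ ≤ ⋯ ≤ q_k ≤ 1` and
`0 ≤ m₀ ≤ ⋯ ≤ m_{k-1} ≤ 1`. -/
structure RSBParams (k : ℕ) where
  q : Fin (k + 1) → ℝ
  m : Fin k → ℝ
  q_mono : Monotone q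
  q_mem : ∀ l, q l ∈ Set.Icc (0 : ℝ) 1
  m_mono : Monotone m
  m_mem : ∀ l, m l ∈ Set.Icc (0 : ℝ) 1

/-- `E[f(g)^m]^(1/m)` for `g` standard Gaussian; for `m = 0` this is read as its limit
`exp E[log f(g)]` as `m` decreases to `0`. -/
noncomputable def gaussPowerMean (m : ℝ) (f : ℝ → ℝ) : ℝ :=
  if m = 0 then Real.exp (∫ x, Real.log (f x) ∂(gaussianReal 0 1))
  else (∫ x, f x ^ m ∂(gaussianReal 0 1)) ^ (1 / m)

/-- `√q₀ g₀ + √(q₁ - q₀) g₁ + ⋯ + √(q_k - q_{k-1}) g_k`. -/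
noncomputable def field {k : ℕ} (p : RSBParams k) (g : Fin (k + 1) → ℝ) : ℝ :=
  Real.sqrt (p.q 0) * g 0
    + ∑ i : Fin k, Real.sqrt (p.q i.succ - p.q i.castSucc) * g i.succ

/-- The variables `Z_k, Z_{k-1}, …, Z_0`, as functions of `(g₀, …, g_k)`:
`Z_k = 2 cosh (β · field)` and `Z_i = E[Z_{i+1} ^ m_i | g₀, …, g_i] ^ (1 / m_i)`. As `Z_{i+1}` depends
on `g₀, …, g_{i+1}` only and the `g`'s are independent, the conditional expectation is the integral
over the coordinate `g_{i+1}`. -/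
noncomputable def rsbZ {k : ℕ} (β : ℝ) (p : RSBParams k) (i : Fin (k + 1)) :
    (Fin (k + 1) → ℝ) → ℝ :=
  Fin.reverseInduction (motive := fun _ => (Fin (k + 1) → ℝ) → ℝ)
    (fun g => 2 * Real.cosh (β * field p g))
    (fun i Z g => gaussPowerMean (p.m i) (fun x => Z (Function.update g i.succ x))) i

/-- `F(q, m) = E log Z_0`, with `g₀, …, g_k` i.i.d. standard Gaussian. -/
noncomputable def rsbF {k : ℕ} (β : ℝ) (p : RSBParams k) : ℝ :=
  ∫ g, Real.log (rsbZ β p 0 g) ∂(Measure.pi fun _ : Fin (k + 1) => gaussianReal 0 1)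

/-- The `k`RSB free energy functional
`(β² / 4) (1 - 2 q_k) + (β² / 4) ∑_{l=0}^k (m_l - m_{l-1}) q_l² + F(q, m)`,
with the conventions `m_{-1} = 0` and `m_k = 1`. -/
noncomputable def rsbFunctional {k : ℕ} (β : ℝ) (p : RSBParams k) : ℝ :=
  β ^ 2 / 4 * (1 - 2 * p.q (Fin.last k))
    + β ^ 2 / 4 * ∑ l : Fin (k + 1),
        (Fin.snoc (α := fun _ => ℝ) p.m 1 l - Fin.cons (α := fun _ => ℝ) 0 p.m l) * p.q l ^ 2
    + rsbF β p

end SK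

/-! Everything rests on one Gaussian interpolation, used twice. Each Gaussian coordinate gets the
amplitude `b sin θ + c cos θ` with `b c = 0`, so that θ leads from the family with amplitudes `c` to
the one with amplitudes `b`; this is the usual interpolation with `t = sin² θ`, made smooth at the
endpoints. `Flow` records the inequality `∂_θ U + sin θ cos θ ∑ ρ_i (∂_i² U + m (∂_i U)²) ≤ κ sin θ
cos θ`. It has four properties. Log-sum-exp satisfies it with `m = 1`, where the bracket is a Gibbs
average of squared coefficients (`flow_logSumExp`). Averaging coordinate `i` through `(1/m) log E
exp (m ·)` preserves it and subtracts `b² - c²` from `ρ_i`, because this is heat flow acting on `exp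
(m U)` (`Flow.smoothLog`). Lowering `m` costs only a lower bound of `∑ ρ_i x_i²` over gradients
(`Flow.weaken`); gradients stay in the convex hull of the coefficient vectors, where a bound on
pairs of configurations suffices (`le_quadratic_of_mem_convexHull`). At `m = 0`, averaging out all
remaining coordinates exhausts `ρ`, and the inequality integrates over `[0, π/2]`
(`Flow.integral_le`).

Comparing two independent systems with their union gives superadditivity of `E log Z_n`
(`meanFreeEnergy_add_le`), hence a limit by Fekete. Comparing the SK model with independent random
fields, and lowering `m` through the levels `1 = m_k, m_{k-1}, …, m_0, 0`, gives Guerra's bound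
(`meanFreeEnergy_le`): at each level the covariance form is a perfect square minus `β² n q_l² / 2`,
the square is dropped, and the constants add up to the functional.

Finally `log Z_n` is Lipschitz in the Gaussian entries, hence exponentially concentrated
(`freeEnergy_deviation`). Borel–Cantelli makes the convergence almost sure; it uses only the law of
each `G_n`, so the coupling between different `n` is irrelevant. -/

namespace SK

/-! ### Functions of exponential growth -/

section Growth

variable {E : Type*} [NormedAddCommGroup E]

/-- At most exponential growth at infinity. -/
def ExpGrowth (f : E → ℝ) : Prop :=
  ∃ C c : ℝ, 0 ≤ C ∧ 0 ≤ c ∧ ∀ x, |f x| ≤ C * Real.exp (c * ‖x‖)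

lemma ExpGrowth.of_le {f h : E → ℝ} (hh : ExpGrowth h) (hle : ∀ x, |f x| ≤ |h x|) :
    ExpGrowth f := by
  obtain ⟨C, c, hC, hc, H⟩ := hh
  exact ⟨C, c, hC, hc, fun x => (hle x).trans (H x)⟩

lemma ExpGrowth.of_bounded {f : E → ℝ} {B : ℝ} (hB : ∀ x, |f x| ≤ B) : ExpGrowth f :=
  ⟨|B|, 0, abs_nonneg _, le_rfl, fun x => by simpa using (hB x).trans (le_abs_self B)⟩

lemma ExpGrowth.mul {f h : E → ℝ} (hf : ExpGrowth f) (hh : ExpGrowth h) :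
    ExpGrowth fun x => f x * h x := by
  obtain ⟨C, c, hC, hc, H⟩ := hf
  obtain ⟨D, d, hD, hd, K⟩ := hh
  refine ⟨C * D, c + d, by positivity, by positivity, fun x => ?_⟩
  rw [abs_mul, add_mul, Real.exp_add]
  calc |f x| * |h x| ≤ (C * Real.exp (c * ‖x‖)) * (D * Real.exp (d * ‖x‖)) :=
        mul_le_mul (H x) (K x) (abs_nonneg _) (by positivity)
    _ = _ := by ring

lemma ExpGrowth.const_mul {f : E → ℝ} (hf : ExpGrowth f) (a : ℝ) :
    ExpGrowth fun x => a * f x :=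
  (ExpGrowth.of_bounded (f := fun _ : E => a) (B := |a|) fun _ => le_rfl).mul hf

lemma ExpGrowth.add {f h : E → ℝ} (hf : ExpGrowth f) (hh : ExpGrowth h) :
    ExpGrowth fun x => f x + h x := by
  obtain ⟨C, c, hC, hc, H⟩ := hf
  obtain ⟨D, d, hD, hd, K⟩ := hh
  refine ⟨C + D, c + d, by positivity, by positivity, fun x => ?_⟩
  have h1 : Real.exp (c * ‖x‖) ≤ Real.exp ((c + d) * ‖x‖) := by
    gcongr; linarith
  have h2 : Real.exp (d * ‖x‖) ≤ Real.exp ((c + d) * ‖x‖) := by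
    gcongr; linarith
  calc |f x + h x| ≤ |f x| + |h x| := abs_add_le _ _
    _ ≤ C * Real.exp (c * ‖x‖) + D * Real.exp (d * ‖x‖) := add_le_add (H x) (K x)
    _ ≤ C * Real.exp ((c + d) * ‖x‖) + D * Real.exp ((c + d) * ‖x‖) := by gcongr
    _ = _ := by ring

lemma expGrowth_norm : ExpGrowth fun x : E => ‖x‖ :=
  ⟨1, 1, zero_le_one, zero_le_one, fun x => by
    rw [abs_of_nonneg (norm_nonneg x), one_mul, one_mul]
    linarith [Real.add_one_le_exp ‖x‖]⟩

/-- A function bounded by an affine function of the norm has an exponential of exponential growth. -/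
lemma expGrowth_exp {f : E → ℝ} {A c : ℝ} (hc : 0 ≤ c) (h : ∀ x, f x ≤ A + c * ‖x‖) :
    ExpGrowth fun x => Real.exp (f x) :=
  ⟨Real.exp A, c, (Real.exp_pos _).le, hc, fun x => by
    rw [abs_of_pos (Real.exp_pos _), ← Real.exp_add]
    exact Real.exp_le_exp.2 (h x)⟩

lemma ExpGrowth.of_affine {f : E → ℝ} {A c : ℝ} (h : ∀ x, |f x| ≤ A + c * ‖x‖) :
    ExpGrowth f := by
  have h1 : ExpGrowth fun x : E => A + c * ‖x‖ :=
    (ExpGrowth.of_bounded (f := fun _ : E => A) (B := |A|) fun _ => le_rfl).add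
      (expGrowth_norm.const_mul c)
  exact h1.of_le fun x => (h x).trans (le_abs_self _)

end Growth

/-! ### One-dimensional Gaussian integrals and integration by parts -/

lemma integrable_exp_abs (C c : ℝ) :
    Integrable (fun g : ℝ => C * Real.exp (c * |g|)) (gaussianReal 0 1) :=
  (integrable_exp_mul_abs (X := fun g : ℝ => g) (integrable_exp_mul_gaussianReal c)
    (integrable_exp_mul_gaussianReal (-c))).const_mul C

lemma integrable_of_expGrowth {f : ℝ → ℝ} (hc : Continuous f) (hg : ExpGrowth f) :
    Integrable f (gaussianReal 0 1) := by
  obtain ⟨C, c, -, -, H⟩ := hg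
  exact (integrable_exp_abs C c).mono' hc.aestronglyMeasurable
    (Eventually.of_forall fun x => by simpa using H x)

lemma integrable_gaussianPDF_mul {f : ℝ → ℝ} (hf : Integrable f (gaussianReal 0 1)) :
    Integrable (fun x => f x * gaussianPDFReal 0 1 x) := by
  rw [gaussianReal_of_var_ne_zero 0 one_ne_zero,
    integrable_withDensity_iff_integrable_smul' (measurable_gaussianPDF 0 1)
      (Eventually.of_forall fun x => gaussianPDF_lt_top)] at hf
  simpa [gaussianPDF, ENNReal.toReal_ofReal (gaussianPDFReal_nonneg 0 1 _), mul_comm] using hf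

lemma hasDerivAt_gaussianPDFReal (x : ℝ) :
    HasDerivAt (gaussianPDFReal 0 1) (-(x * gaussianPDFReal 0 1 x)) x := by
  rw [gaussianPDFReal_def]
  have h : HasDerivAt (fun x : ℝ => -(x - 0) ^ 2 / (2 * ((1 : NNReal) : ℝ))) (-x) x := by
    have h1 : HasDerivAt (fun x : ℝ => -x ^ 2 / 2) (-x) x :=
      ((hasDerivAt_pow 2 x).neg.div_const 2).congr_deriv (by push_cast; ring)
    simpa using h1
  refine (h.exp.const_mul ((√(2 * Real.pi * ((1 : NNReal) : ℝ)))⁻¹)).congr_deriv ?_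
  beta_reduce
  ring

/-- Gaussian integration by parts. -/
lemma integral_id_mul_gaussian {f f' : ℝ → ℝ} (hd : ∀ x, HasDerivAt f (f' x) x)
    (hc' : Continuous f') (hf : ExpGrowth f) (hf' : ExpGrowth f') :
    ∫ x, x * f x ∂(gaussianReal 0 1) = ∫ x, f' x ∂(gaussianReal 0 1) := by
  have hc : Continuous f := continuous_iff_continuousAt.2 fun x => (hd x).continuousAt
  have i1 := integrable_gaussianPDF_mul (integrable_of_expGrowth hc hf)
  have i2 := integrable_gaussianPDF_mul (integrable_of_expGrowth hc' hf')
  have i3 := integrable_gaussianPDF_mul (integrable_of_expGrowth (continuous_id.mul hc)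
    (ExpGrowth.mul (expGrowth_norm.of_le fun x => by simp) hf))
  have key := integral_mul_deriv_eq_deriv_mul_of_integrable (u := f) (u' := f')
    (v := gaussianPDFReal 0 1) (v' := fun x => -(x * gaussianPDFReal 0 1 x))
    (fun x _ => hd x) (fun x _ => hasDerivAt_gaussianPDFReal x)
    (by convert i3.neg using 1; ext x; simp; ring) i2 i1
  rw [integral_gaussianReal_eq_integral_smul one_ne_zero,
    integral_gaussianReal_eq_integral_smul one_ne_zero]
  simp only [smul_eq_mul]
  have e1 : ∫ x, gaussianPDFReal 0 1 x * (x * f x)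
      = -∫ x, f x * -(x * gaussianPDFReal 0 1 x) := by
    rw [← integral_neg]; congr 1; ext x; ring
  rw [e1, key, neg_neg]
  congr 1; ext x; ring

/-! ### Gaussian averaging of one coordinate with θ-dependent amplitude -/

section Smoothing

variable {ι : Type*} [Fintype ι] [DecidableEq ι]

/-- The amplitude `b sin θ + c cos θ`. -/
noncomputable def amp (b c θ : ℝ) : ℝ := b * Real.sin θ + c * Real.cos θ

/-- The derivative of `amp` in `θ`. -/
noncomputable def ampDeriv (b c θ : ℝ) : ℝ := b * Real.cos θ - c * Real.sin θ

lemma hasDerivAt_amp (b c θ : ℝ) : HasDerivAt (amp b c) (ampDeriv b c θ) θ := by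
  refine (((Real.hasDerivAt_sin θ).const_mul b).add
    ((Real.hasDerivAt_cos θ).const_mul c)).congr_deriv ?_
  simp only [ampDeriv]; ring

lemma continuous_amp (b c : ℝ) : Continuous (amp b c) := by
  unfold amp; fun_prop

lemma continuous_ampDeriv (b c : ℝ) : Continuous (ampDeriv b c) := by
  unfold ampDeriv; fun_prop

lemma abs_amp_le (b c θ : ℝ) : |amp b c θ| ≤ |b| + |c| := by
  refine (abs_add_le _ _).trans ?_
  rw [abs_mul, abs_mul]
  exact add_le_add (mul_le_of_le_one_right (abs_nonneg _) (Real.abs_sin_le_one θ))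
    (mul_le_of_le_one_right (abs_nonneg _) (Real.abs_cos_le_one θ))

lemma abs_ampDeriv_le (b c θ : ℝ) : |ampDeriv b c θ| ≤ |b| + |c| := by
  refine (abs_sub _ _).trans ?_
  rw [abs_mul, abs_mul]
  exact add_le_add (mul_le_of_le_one_right (abs_nonneg _) (Real.abs_cos_le_one θ))
    (mul_le_of_le_one_right (abs_nonneg _) (Real.abs_sin_le_one θ))

/-- Half the derivative of the variance of the perturbation. The condition `b c = 0` kills the `cos
2θ` term, so all coordinates share the common factor `sin θ cos θ`. -/
lemma amp_mul_ampDeriv {b c : ℝ} (h : b * c = 0) (θ : ℝ) :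
    amp b c θ * ampDeriv b c θ = (b ^ 2 - c ^ 2) * (Real.sin θ * Real.cos θ) := by
  simp only [amp, ampDeriv]
  linear_combination (Real.cos θ ^ 2 - Real.sin θ ^ 2) * h

/-- The Gaussian perturbation of coordinate `i`. -/
noncomputable def shift (i : ι) (b c : ℝ) (p : ℝ × (ι → ℝ)) (g : ℝ) : ℝ × (ι → ℝ) :=
  (p.1, p.2 + Pi.single i (amp b c p.1 * g))

omit [Fintype ι] in
lemma continuous_shift (i : ι) (b c : ℝ) :
    Continuous fun q : (ℝ × (ι → ℝ)) × ℝ => shift i b c q.1 q.2 := by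
  have h := continuous_amp b c
  have h2 : Continuous fun x : ℝ => (Pi.single i x : ι → ℝ) :=
    continuous_single (A := fun _ : ι => ℝ) i
  unfold shift
  fun_prop

omit [Fintype ι] in
lemma continuous_shift_right (i : ι) (b c : ℝ) (p : ℝ × (ι → ℝ)) : Continuous (shift i b c p) :=
  (continuous_shift i b c).comp (f := fun g => (p, g)) (by fun_prop)

lemma norm_shift_le (i : ι) (b c : ℝ) (p : ℝ × (ι → ℝ)) (g : ℝ) :
    ‖shift i b c p g‖ ≤ ‖p‖ + (|b| + |c|) * |g| := by
  have h1 : shift i b c p g = p + (0, Pi.single i (amp b c p.1 * g)) := by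
    ext <;> simp [shift]
  rw [h1]
  refine (norm_add_le _ _).trans (add_le_add le_rfl ?_)
  have : ‖(Pi.single i (amp b c p.1 * g) : ι → ℝ)‖ = |amp b c p.1 * g| := by
    rw [Pi.norm_single, Real.norm_eq_abs]
  rw [Prod.norm_def, this, norm_zero, max_eq_right (abs_nonneg _), abs_mul]
  exact mul_le_mul_of_nonneg_right (abs_amp_le b c p.1) (abs_nonneg g)

lemma ExpGrowth.shift_bound {ψ : ℝ × (ι → ℝ) → ℝ} (h : ExpGrowth ψ) (i : ι) (b c : ℝ) :
    ∃ C d : ℝ, 0 ≤ C ∧ 0 ≤ d ∧ ∀ p g, |ψ (shift i b c p g)|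
      ≤ C * Real.exp (d * ‖p‖) * Real.exp (d * (|b| + |c|) * |g|) := by
  obtain ⟨C, d, hC, hd, H⟩ := h
  refine ⟨C, d, hC, hd, fun p g => (H _).trans ?_⟩
  rw [mul_assoc C, ← Real.exp_add]
  refine mul_le_mul_of_nonneg_left (Real.exp_le_exp.2 ?_) hC
  nlinarith [mul_le_mul_of_nonneg_left (norm_shift_le i b c p g) hd]

lemma ExpGrowth.comp_shift {ψ : ℝ × (ι → ℝ) → ℝ} (h : ExpGrowth ψ) (i : ι) (b c : ℝ)
    (p : ℝ × (ι → ℝ)) : ExpGrowth fun g => ψ (shift i b c p g) := by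
  obtain ⟨C, d, hC, hd, H⟩ := h.shift_bound i b c
  exact ⟨C * Real.exp (d * ‖p‖), d * (|b| + |c|), by positivity, by positivity, fun g => H p g⟩

lemma integrable_comp_shift {ψ : ℝ × (ι → ℝ) → ℝ} (hc : Continuous ψ) (h : ExpGrowth ψ)
    (i : ι) (b c : ℝ) (p : ℝ × (ι → ℝ)) :
    Integrable (fun g => ψ (shift i b c p g)) (gaussianReal 0 1) :=
  integrable_of_expGrowth (hc.comp (continuous_shift_right i b c p))
    (h.comp_shift i b c p)

/-- Average over a Gaussian perturbation of coordinate `i`. -/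
noncomputable def smooth (i : ι) (b c : ℝ) (ψ : ℝ × (ι → ℝ) → ℝ) (p : ℝ × (ι → ℝ)) : ℝ :=
  ∫ g, ψ (shift i b c p g) ∂(gaussianReal 0 1)

lemma norm_le_of_mem_ball {E : Type*} [NormedAddCommGroup E] {p q : E}
    (h : q ∈ Metric.ball p 1) : ‖q‖ ≤ ‖p‖ + 1 := by
  have h1 : ‖q - p‖ < 1 := by simpa [dist_eq_norm] using h
  have h2 := norm_le_norm_add_norm_sub' q p
  linarith

lemma continuous_smooth {ψ : ℝ × (ι → ℝ) → ℝ} (hc : Continuous ψ) (h : ExpGrowth ψ)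
    (i : ι) (b c : ℝ) : Continuous (smooth i b c ψ) := by
  obtain ⟨C, d, hC, hd, H⟩ := h.shift_bound i b c
  have hcs : Continuous fun q : (ℝ × (ι → ℝ)) × ℝ => ψ (shift i b c q.1 q.2) :=
    hc.comp (continuous_shift i b c)
  refine continuous_iff_continuousAt.2 fun p => ?_
  refine continuousAt_of_dominated
    (bound := fun g => C * Real.exp (d * (‖p‖ + 1)) * Real.exp (d * (|b| + |c|) * |g|))
    (Eventually.of_forall fun q =>
      (hc.comp (continuous_shift_right i b c q)).aestronglyMeasurable) ?_
    (integrable_exp_abs _ _)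
    (Eventually.of_forall fun g =>
      (hcs.comp (Continuous.prodMk continuous_id continuous_const)).continuousAt)
  filter_upwards [Metric.ball_mem_nhds p one_pos] with q hq
  refine Eventually.of_forall fun g => (H q g).trans ?_
  have := norm_le_of_mem_ball hq
  gcongr

lemma ExpGrowth.smooth {ψ : ℝ × (ι → ℝ) → ℝ} (h : ExpGrowth ψ)
    (i : ι) (b c : ℝ) : ExpGrowth (smooth i b c ψ) := by
  obtain ⟨C, d, hC, hd, H⟩ := h.shift_bound i b c
  refine ⟨C * ∫ g, 1 * Real.exp (d * (|b| + |c|) * |g|) ∂(gaussianReal 0 1), d,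
    mul_nonneg hC (integral_nonneg fun g => by positivity), hd, fun p => ?_⟩
  have h1 := norm_integral_le_of_norm_le (f := fun g => ψ (shift i b c p g))
    ((integrable_exp_abs 1 (d * (|b| + |c|))).const_mul (C * Real.exp (d * ‖p‖)))
    (Eventually.of_forall fun g => by simpa using H p g)
  rw [integral_const_mul] at h1
  refine h1.trans (le_of_eq ?_)
  ring

/-- The linear form with the given partial derivatives. -/
noncomputable def fd (τ : ℝ) (ξ : ι → ℝ) : ℝ × (ι → ℝ) →L[ℝ] ℝ :=
  τ • ContinuousLinearMap.fst ℝ ℝ (ι → ℝ)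
    + ∑ j, ξ j • (ContinuousLinearMap.proj (R := ℝ) (φ := fun _ : ι => ℝ) j).comp
        (ContinuousLinearMap.snd ℝ ℝ (ι → ℝ))

omit [DecidableEq ι] in
@[simp] lemma fd_apply (τ : ℝ) (ξ : ι → ℝ) (p : ℝ × (ι → ℝ)) :
    fd τ ξ p = τ * p.1 + ∑ j, ξ j * p.2 j := by
  simp [fd]

omit [DecidableEq ι] in
lemma norm_fd_le (τ : ℝ) (ξ : ι → ℝ) : ‖fd τ ξ‖ ≤ |τ| + ∑ j, |ξ j| := by
  refine ContinuousLinearMap.opNorm_le_bound _ (by positivity) fun p => ?_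
  rw [fd_apply, Real.norm_eq_abs, add_mul, Finset.sum_mul]
  refine (abs_add_le _ _).trans (add_le_add ?_ ((Finset.abs_sum_le_sum_abs _ _).trans
    (Finset.sum_le_sum fun j _ => ?_)))
  · rw [abs_mul]
    exact mul_le_mul_of_nonneg_left (norm_fst_le p) (abs_nonneg _)
  · rw [abs_mul]
    exact mul_le_mul_of_nonneg_left ((norm_le_pi_norm p.2 j).trans (norm_snd_le p)) (abs_nonneg _)

omit [DecidableEq ι] in
lemma integral_fd {μ : Measure ℝ} {τ : ℝ → ℝ} {ξ : ι → ℝ → ℝ} (hτ : Integrable τ μ)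
    (hξ : ∀ j, Integrable (ξ j) μ) :
    ∫ g, fd (τ g) (fun j => ξ j g) ∂μ = fd (∫ g, τ g ∂μ) (fun j => ∫ g, ξ j g ∂μ) := by
  unfold fd
  rw [integral_add (hτ.smul_const _) (integrable_finsetSum _ fun j _ => (hξ j).smul_const _),
    integral_smul_const, integral_finsetSum _ fun j _ => (hξ j).smul_const _]
  simp only [integral_smul_const]

omit [DecidableEq ι] in
lemma continuous_fd {X : Type*} [TopologicalSpace X] {τ : X → ℝ} {ξ : ι → X → ℝ}
    (hτ : Continuous τ) (hξ : ∀ j, Continuous (ξ j)) :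
    Continuous fun x => fd (τ x) (fun j => ξ j x) := by
  unfold fd
  fun_prop

/-- Joint differentiability, with pure second derivatives in the coordinate directions. -/
structure HasDerivs (ψ ψt : ℝ × (ι → ℝ) → ℝ) (ψ1 ψ2 : ι → ℝ × (ι → ℝ) → ℝ) : Prop where
  hasFDerivAt : ∀ p, HasFDerivAt ψ (fd (ψt p) fun j => ψ1 j p) p
  second : ∀ j p, HasDerivAt (fun s : ℝ => ψ1 j (p.1, p.2 + Pi.single j s)) (ψ2 j p) 0
  cont_t : Continuous ψt
  cont1 : ∀ j, Continuous (ψ1 j)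
  cont2 : ∀ j, Continuous (ψ2 j)

lemma HasDerivs.cont {ψ ψt : ℝ × (ι → ℝ) → ℝ} {ψ1 ψ2 : ι → ℝ × (ι → ℝ) → ℝ}
    (h : HasDerivs ψ ψt ψ1 ψ2) : Continuous ψ :=
  continuous_iff_continuousAt.2 fun p => (h.hasFDerivAt p).continuousAt

lemma HasDerivs.second' {ψ ψt : ℝ × (ι → ℝ) → ℝ} {ψ1 ψ2 : ι → ℝ × (ι → ℝ) → ℝ}
    (h : HasDerivs ψ ψt ψ1 ψ2) (j : ι) (θ : ℝ) (x : ι → ℝ) (s : ℝ) :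
    HasDerivAt (fun s : ℝ => ψ1 j (θ, x + Pi.single j s)) (ψ2 j (θ, x + Pi.single j s)) s := by
  have h1 := h.second j (θ, x + Pi.single j s)
  have h2 : HasDerivAt (fun t : ℝ => t - s) 1 s := (hasDerivAt_id s).sub_const s
  have h3 := HasDerivAt.comp s (by simpa using h1) h2
  refine (h3.congr_of_eventuallyEq (Eventually.of_forall fun t => ?_)).congr_deriv (by ring)
  simp [add_assoc, ← Pi.single_add]

/-- Exponential growth of a function and of its derivatives. -/
structure HeatReg (ψ ψt : ℝ × (ι → ℝ) → ℝ) (ψ1 ψ2 : ι → ℝ × (ι → ℝ) → ℝ) : Prop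
    extends HasDerivs ψ ψt ψ1 ψ2 where
  growth : ExpGrowth ψ
  growth_t : ExpGrowth ψt
  growth1 : ∀ j, ExpGrowth (ψ1 j)
  growth2 : ∀ j, ExpGrowth (ψ2 j)

lemma hasFDerivAt_shift (i : ι) (b c : ℝ) (p : ℝ × (ι → ℝ)) (g : ℝ) :
    HasFDerivAt (fun q => shift i b c q g)
      (ContinuousLinearMap.id ℝ (ℝ × (ι → ℝ)) +
        (ContinuousLinearMap.fst ℝ ℝ (ι → ℝ)).smulRight
          (((0 : ℝ), Pi.single i (ampDeriv b c p.1 * g)) : ℝ × (ι → ℝ))) p := by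
  have h1 : HasFDerivAt (fun q : ℝ × (ι → ℝ) => amp b c q.1)
      (ampDeriv b c p.1 • ContinuousLinearMap.fst ℝ ℝ (ι → ℝ)) p :=
    (hasDerivAt_amp b c p.1).comp_hasFDerivAt p hasFDerivAt_fst
  have h2 := (hasFDerivAt_id (𝕜 := ℝ) p).add
    (h1.smul_const (((0 : ℝ), Pi.single i g) : ℝ × (ι → ℝ)))
  refine (h2.congr_of_eventuallyEq (Eventually.of_forall fun q => ?_)).congr_fderiv ?_
  · ext j
    · simp [shift]
    · simp [shift, ← Pi.single_smul]
  · ext v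
    · simp
    · simp [Pi.single_apply]
    · simp
    · simp

/-- The heat equation: differentiating the amplitude produces `E[g ∂_i ψ]`, and Gaussian integration
by parts turns this into the amplitude times `E[∂_i² ψ]`. Only pure second derivatives ever arise.
-/
lemma HeatReg.smooth {ψ ψt : ℝ × (ι → ℝ) → ℝ} {ψ1 ψ2 : ι → ℝ × (ι → ℝ) → ℝ}
    (h : HeatReg ψ ψt ψ1 ψ2) (i : ι) (b c : ℝ) :
    HeatReg (smooth i b c ψ)
      (fun p => SK.smooth i b c ψt p
        + amp b c p.1 * ampDeriv b c p.1 * SK.smooth i b c (ψ2 i) p)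
      (fun j => SK.smooth i b c (ψ1 j)) (fun j => SK.smooth i b c (ψ2 j)) where
  growth := h.growth.smooth i b c
  growth_t := (h.growth_t.smooth i b c).add
    (ExpGrowth.mul (ExpGrowth.of_bounded (B := (|b| + |c|) * (|b| + |c|)) fun p => by
      rw [abs_mul]
      exact mul_le_mul (abs_amp_le _ _ _) (abs_ampDeriv_le _ _ _) (abs_nonneg _)
        (by positivity)) ((h.growth2 i).smooth i b c))
  growth1 := fun j => (h.growth1 j).smooth i b c
  growth2 := fun j => (h.growth2 j).smooth i b c
  cont_t := by
    have h1 := continuous_smooth h.cont_t h.growth_t i b c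
    have h2 := continuous_smooth (h.cont2 i) (h.growth2 i) i b c
    have h3 := continuous_amp b c
    have h4 := continuous_ampDeriv b c
    fun_prop
  cont1 := fun j => continuous_smooth (h.cont1 j) (h.growth1 j) i b c
  cont2 := fun j => continuous_smooth (h.cont2 j) (h.growth2 j) i b c
  second := fun j p => by
    obtain ⟨C, d, hC, hd, H⟩ := (h.growth2 j).shift_bound i b c
    have e : ∀ s g, shift i b c (p.1, p.2 + Pi.single j s) g
        = (p.1, (p.2 + Pi.single i (amp b c p.1 * g)) + Pi.single j s) := by
      intro s g; simp only [shift]; congr 1; abel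
    have key := hasDerivAt_integral_of_dominated_loc_of_deriv_le (μ := gaussianReal 0 1)
      (F := fun s g => ψ1 j (shift i b c (p.1, p.2 + Pi.single j s) g))
      (F' := fun s g => ψ2 j (shift i b c (p.1, p.2 + Pi.single j s) g))
      (x₀ := 0) (s := Metric.ball 0 1)
      (bound := fun g => C * Real.exp (d * (‖p‖ + 1)) * Real.exp (d * (|b| + |c|) * |g|))
      (Metric.ball_mem_nhds 0 one_pos)
      (Eventually.of_forall fun s =>
        (integrable_comp_shift (h.cont1 j) (h.growth1 j) i b c _).aestronglyMeasurable)
      (integrable_comp_shift (h.cont1 j) (h.growth1 j) i b c _)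
      (integrable_comp_shift (h.cont2 j) (h.growth2 j) i b c _).aestronglyMeasurable
      (Eventually.of_forall fun g s hs => ?_) (integrable_exp_abs _ _)
      (Eventually.of_forall fun g s _ => ?_)
    · simpa [SK.smooth] using key.2
    · refine (H _ g).trans ?_
      have hn : ‖((p.1, p.2 + Pi.single j s) : ℝ × (ι → ℝ))‖ ≤ ‖p‖ + 1 := by
        have e1 : ((p.1, p.2 + Pi.single j s) : ℝ × (ι → ℝ)) = p + (0, Pi.single j s) := by
          ext <;> simp
        rw [e1]
        refine (norm_add_le _ _).trans (add_le_add le_rfl ?_)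
        rw [Prod.norm_def, Pi.norm_single]
        have : |s| < 1 := by simpa using hs
        simpa using this.le
      gcongr
    · simp only [e]
      exact h.second' j _ _ s
  hasFDerivAt := fun p => by
    obtain ⟨Ct, dt, hCt, hdt, Ht⟩ := h.growth_t.shift_bound i b c
    choose C d hC hd H using fun j => (h.growth1 j).shift_bound i b c
    have hs : Continuous fun g => shift i b c p g := continuous_shift_right i b c p
    have key := hasFDerivAt_integral_of_dominated_of_fderiv_le (μ := gaussianReal 0 1) (𝕜 := ℝ)
      (F := fun q g => ψ (shift i b c q g))
      -- θ enters both directly and through the amplitude. The second route leaves a factor `g`,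
      -- which the majorant absorbs by raising its exponential rate by 1.
      (F' := fun q g => fd (ψt (shift i b c q g)
          + ampDeriv b c q.1 * (g * ψ1 i (shift i b c q g)))
        (fun j => ψ1 j (shift i b c q g)))
      (x₀ := p) (s := Metric.ball p 1)
      (bound := fun g => (Ct * Real.exp (dt * (‖p‖ + 1)) * Real.exp (dt * (|b| + |c|) * |g|)
          + (|b| + |c|) * (C i * Real.exp (d i * (‖p‖ + 1))
            * Real.exp ((d i * (|b| + |c|) + 1) * |g|)))
        + ∑ j, C j * Real.exp (d j * (‖p‖ + 1)) * Real.exp (d j * (|b| + |c|) * |g|))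
      (Metric.ball_mem_nhds p one_pos)
      (Eventually.of_forall fun q =>
        (integrable_comp_shift h.cont h.growth i b c _).aestronglyMeasurable)
      (integrable_comp_shift h.cont h.growth i b c _)
      (continuous_fd (by have := h.cont_t; have := h.cont1 i; fun_prop)
        (fun j => (h.cont1 j).comp hs)).aestronglyMeasurable
      (Eventually.of_forall fun g q hq => ?_)
      (((integrable_exp_abs _ _).add ((integrable_exp_abs _ _).const_mul _)).add
        (integrable_finsetSum _ fun j _ => integrable_exp_abs _ _))
      (Eventually.of_forall fun g q _ => ?_)
    · have i1 := integrable_comp_shift h.cont_t h.growth_t i b c p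
      have i2 : Integrable (fun g => g * ψ1 i (shift i b c p g)) (gaussianReal 0 1) :=
        integrable_of_expGrowth (by have := h.cont1 i; fun_prop)
          (ExpGrowth.mul (expGrowth_norm.of_le fun x => by simp)
            ((h.growth1 i).comp_shift i b c p))
      rw [integral_fd (τ := fun g => ψt (shift i b c p g)
          + ampDeriv b c p.1 * (g * ψ1 i (shift i b c p g))) (i1.add (i2.const_mul _))
        (fun j => integrable_comp_shift (h.cont1 j) (h.growth1 j) i b c p)] at key
      have ibp := integral_id_mul_gaussian (f := fun g => ψ1 i (shift i b c p g))
        (f' := fun g => amp b c p.1 * ψ2 i (shift i b c p g))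
        (fun g => by
          have h1 : HasDerivAt (fun g : ℝ => amp b c p.1 * g) (amp b c p.1) g := by
            simpa using (hasDerivAt_id g).const_mul (amp b c p.1)
          exact (HasDerivAt.comp g (h.second' i p.1 p.2 (amp b c p.1 * g)) h1).congr_deriv
            (mul_comm _ _))
        (by have := h.cont2 i; fun_prop) ((h.growth1 i).comp_shift i b c p)
        (((h.growth2 i).comp_shift i b c p).const_mul _)
      have e1 : ∫ g, (ψt (shift i b c p g)
            + ampDeriv b c p.1 * (g * ψ1 i (shift i b c p g))) ∂(gaussianReal 0 1)
          = SK.smooth i b c ψt p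
            + amp b c p.1 * ampDeriv b c p.1 * SK.smooth i b c (ψ2 i) p := by
        rw [integral_add i1 (i2.const_mul _), integral_const_mul, ibp, integral_const_mul]
        simp only [SK.smooth]; ring
      rw [e1] at key
      exact key
    · have hn := norm_le_of_mem_ball hq
      have hb : 0 ≤ |b| + |c| := by positivity
      refine (norm_fd_le _ _).trans (add_le_add ((abs_add_le _ _).trans (add_le_add ?_ ?_))
        (Finset.sum_le_sum fun j _ => ?_))
      · refine (Ht q g).trans ?_
        gcongr
      · rw [abs_mul, abs_mul]
        refine mul_le_mul (abs_ampDeriv_le _ _ _) ?_ (by positivity) hb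
        have hg : |g| ≤ Real.exp |g| := by linarith [Real.add_one_le_exp |g|]
        have := hC i
        have := hd i
        calc |g| * |ψ1 i (shift i b c q g)|
            ≤ Real.exp |g| * (C i * Real.exp (d i * ‖q‖)
                * Real.exp (d i * (|b| + |c|) * |g|)) :=
              mul_le_mul hg (H i q g) (abs_nonneg _) (Real.exp_pos _).le
          _ ≤ Real.exp |g| * (C i * Real.exp (d i * (‖p‖ + 1))
                * Real.exp (d i * (|b| + |c|) * |g|)) := by gcongr
          _ = _ := by rw [add_mul, Real.exp_add, one_mul]; ring
      · have := hC j
        have := hd j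
        refine (H j q g).trans ?_
        gcongr
    · refine ((h.hasFDerivAt (shift i b c q g)).comp q (hasFDerivAt_shift i b c q g)).congr_fderiv
        ?_
      ext v
      · simp [Pi.single_apply]
        ring
      · simp

end Smoothing

/-! ### The operator (1/m) log E exp(m ·) and the flow inequality -/

/-- `(1 / m) log E exp (m f(g))` for `g` standard Gaussian, and `E f(g)` if `m = 0`. -/
noncomputable def logMean (m : ℝ) (f : ℝ → ℝ) : ℝ :=
  if m = 0 then ∫ g, f g ∂(gaussianReal 0 1)
  else (1 / m) * Real.log (∫ g, Real.exp (m * f g) ∂(gaussianReal 0 1))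

section Flow

variable {ι : Type*} [Fintype ι] [DecidableEq ι]

/-- The operator `logMean m` applied to a Gaussian perturbation of coordinate `i`. -/
noncomputable def smoothLog (m : ℝ) (i : ι) (b c : ℝ) (U : ℝ × (ι → ℝ) → ℝ)
    (p : ℝ × (ι → ℝ)) : ℝ :=
  logMean m fun g => U (shift i b c p g)

/-- Bounded derivatives, the gradient in the space variable being in `K`. -/
structure Reg (K : Set (ι → ℝ)) (U Ut : ℝ × (ι → ℝ) → ℝ) (U1 U2 : ι → ℝ × (ι → ℝ) → ℝ) : Prop
    extends HasDerivs U Ut U1 U2 where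
  bdd_t : ∃ B, ∀ p, |Ut p| ≤ B
  bdd2 : ∀ j, ∃ B, ∀ p, |U2 j p| ≤ B
  mem : ∀ p, (fun j => U1 j p) ∈ K

variable {K : Set (ι → ℝ)} {U Ut : ℝ × (ι → ℝ) → ℝ} {U1 U2 : ι → ℝ × (ι → ℝ) → ℝ}

lemma Reg.bdd1 (h : Reg K U Ut U1 U2) (hK : IsCompact K) : ∃ V, ∀ j p, |U1 j p| ≤ V := by
  obtain ⟨V, hV⟩ := hK.isBounded.exists_norm_le
  exact ⟨V, fun j p => (norm_le_pi_norm (fun j => U1 j p) j).trans (hV _ (h.mem p))⟩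

/-- The derivative is bounded, so the mean value inequality applies. This is what makes every `exp
(m U)` Gaussian integrable. -/
lemma Reg.abs_le (h : Reg K U Ut U1 U2) (hK : IsCompact K) :
    ∃ A c, 0 ≤ c ∧ ∀ p, |U p| ≤ A + c * ‖p‖ := by
  obtain ⟨B, hB⟩ := h.bdd_t
  obtain ⟨V, hV⟩ := h.bdd1 hK
  have hb : ∀ p, ‖fd (Ut p) fun j => U1 j p‖ ≤ B + ∑ _j : ι, V := fun p =>
    (norm_fd_le _ _).trans (add_le_add (hB p) (Finset.sum_le_sum fun j _ => hV j p))
  refine ⟨|U 0|, B + ∑ _j : ι, V, (norm_nonneg _).trans (hb 0), fun p => ?_⟩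
  have := convex_univ.norm_image_sub_le_of_norm_hasFDerivWithin_le (x := (0 : ℝ × (ι → ℝ))) (y := p)
    (fun p _ => (h.hasFDerivAt p).hasFDerivWithinAt) (fun p _ => hb p)
    (Set.mem_univ _) (Set.mem_univ _)
  rw [sub_zero, Real.norm_eq_abs] at this
  linarith [abs_sub_abs_le_abs_sub (U p) (U 0)]

lemma Reg.growth (h : Reg K U Ut U1 U2) (hK : IsCompact K) : ExpGrowth U := by
  obtain ⟨A, c, -, H⟩ := h.abs_le hK
  exact ExpGrowth.of_affine H

lemma Reg.growth_exp (h : Reg K U Ut U1 U2) (hK : IsCompact K) (m : ℝ) :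
    ExpGrowth fun p => Real.exp (m * U p) := by
  obtain ⟨A, c, hc, H⟩ := h.abs_le hK
  refine expGrowth_exp (A := |m| * A) (c := |m| * c) (by positivity) fun p => ?_
  calc m * U p ≤ |m * U p| := le_abs_self _
    _ = |m| * |U p| := abs_mul _ _
    _ ≤ |m| * (A + c * ‖p‖) := mul_le_mul_of_nonneg_left (H p) (abs_nonneg m)
    _ = _ := by ring

lemma Reg.bdd_mix (h : Reg K U Ut U1 U2) (hK : IsCompact K) (m : ℝ) (j : ι) :
    ∃ B, ∀ p, |U2 j p + m * U1 j p ^ 2| ≤ B := by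
  obtain ⟨V, hV⟩ := h.bdd1 hK
  obtain ⟨B, hB⟩ := h.bdd2 j
  refine ⟨B + |m| * V ^ 2, fun p => (abs_add_le _ _).trans (add_le_add (hB p) ?_)⟩
  rw [abs_mul, abs_pow]
  gcongr
  exact hV j p

lemma Reg.heatReg (h : Reg K U Ut U1 U2) (hK : IsCompact K) : HeatReg U Ut U1 U2 where
  toHasDerivs := h.toHasDerivs
  growth := h.growth hK
  growth_t := ExpGrowth.of_bounded h.bdd_t.choose_spec
  growth1 := fun j => ExpGrowth.of_bounded ((h.bdd1 hK).choose_spec j)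
  growth2 := fun j => ExpGrowth.of_bounded (h.bdd2 j).choose_spec

/-- The combination `∂_j² U + m (∂_j U)²` in the flow inequality is what the second derivative of
`exp (m U)` leaves after division by `m exp (m U)`. -/
lemma Reg.heatReg_exp (h : Reg K U Ut U1 U2) (hK : IsCompact K) (m : ℝ) :
    HeatReg (fun p => Real.exp (m * U p)) (fun p => m * (Ut p * Real.exp (m * U p)))
      (fun j p => m * (U1 j p * Real.exp (m * U p)))
      (fun j p => m * ((U2 j p + m * U1 j p ^ 2) * Real.exp (m * U p))) where
  hasFDerivAt := fun p => by
    refine (((h.hasFDerivAt p).const_mul m).exp).congr_fderiv ?_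
    ext v
    · simp; ring
    · simp only [ContinuousLinearMap.comp_apply, ContinuousLinearMap.inr_apply, fd_apply,
        _root_.smul_apply, smul_eq_mul, mul_zero, zero_add, Finset.mul_sum]
      exact Finset.sum_congr rfl fun j _ => by ring
  second := fun j p => by
    have h0 : (p.1, p.2 + Pi.single j (0 : ℝ)) = p := by simp
    have h1 := h.second j p
    have h2 : HasDerivAt (fun s : ℝ => U (p.1, p.2 + Pi.single j s)) (U1 j p) 0 := by
      have e : HasDerivAt (fun s : ℝ => ((p.1, p.2 + Pi.single j s) : ℝ × (ι → ℝ)))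
          ((0 : ℝ), Pi.single j (1 : ℝ)) 0 :=
        (hasDerivAt_const _ _).prodMk ((hasDerivAt_single j (0 : ℝ)).const_add p.2)
      have := HasFDerivAt.comp_hasDerivAt (0 : ℝ) (by simpa [h0] using h.hasFDerivAt p) e
      refine this.congr_deriv ?_
      simp [Pi.single_apply]
    have h3 := (h1.mul (h2.const_mul m).exp).const_mul m
    refine h3.congr_deriv ?_
    simp only [h0]
    ring
  cont_t := by have := h.cont_t; have := h.cont; fun_prop
  cont1 := fun j => by have := h.cont1 j; have := h.cont; fun_prop
  cont2 := fun j => by have := h.cont1 j; have := h.cont2 j; have := h.cont; fun_prop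
  growth := h.growth_exp hK m
  growth_t := (ExpGrowth.mul (h.heatReg hK).growth_t (h.growth_exp hK m)).const_mul m
  growth1 := fun j => (ExpGrowth.mul ((h.heatReg hK).growth1 j) (h.growth_exp hK m)).const_mul m
  growth2 := fun j => (ExpGrowth.mul
    (ExpGrowth.of_bounded (h.bdd_mix hK m j).choose_spec) (h.growth_exp hK m)).const_mul m

/-- The Gaussian perturbation weighted by `exp (m U)`. -/
noncomputable def tilt (m : ℝ) (i : ι) (b c : ℝ) (U : ℝ × (ι → ℝ) → ℝ) (p : ℝ × (ι → ℝ)) :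
    Measure ℝ :=
  (gaussianReal 0 1).tilted fun g => m * U (shift i b c p g)

/-- Average over the Gaussian perturbation of coordinate `i`, weighted by `exp (m U)`. -/
noncomputable def wavg (m : ℝ) (i : ι) (b c : ℝ) (U f : ℝ × (ι → ℝ) → ℝ)
    (p : ℝ × (ι → ℝ)) : ℝ :=
  ∫ g, f (shift i b c p g) ∂(tilt m i b c U p)

omit [Fintype ι] in
lemma wavg_eq (m : ℝ) (i : ι) (b c : ℝ) (U f : ℝ × (ι → ℝ) → ℝ) (p : ℝ × (ι → ℝ)) :
    wavg m i b c U f p = smooth i b c (fun p => f p * Real.exp (m * U p)) p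
      / smooth i b c (fun p => Real.exp (m * U p)) p := by
  rw [wavg, tilt, integral_tilted]
  simp only [smooth, smul_eq_mul]
  rw [← integral_div]
  congr 1; ext g; ring

omit [Fintype ι] in
lemma wavg_zero (i : ι) (b c : ℝ) (U f : ℝ × (ι → ℝ) → ℝ) (p : ℝ × (ι → ℝ)) :
    wavg 0 i b c U f p = smooth i b c f p := by
  rw [wavg_eq]; simp [smooth]

lemma Reg.isProbabilityMeasure_tilt (h : Reg K U Ut U1 U2) (hK : IsCompact K) (m : ℝ) (i : ι)
    (b c : ℝ) (p : ℝ × (ι → ℝ)) : IsProbabilityMeasure (tilt m i b c U p) :=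
  isProbabilityMeasure_tilted (integrable_comp_shift (h.heatReg_exp hK m).cont
    (h.growth_exp hK m) i b c p)

lemma Reg.smooth_exp_pos (h : Reg K U Ut U1 U2) (hK : IsCompact K) (m : ℝ) (i : ι)
    (b c : ℝ) (p : ℝ × (ι → ℝ)) : 0 < smooth i b c (fun p => Real.exp (m * U p)) p :=
  integral_exp_pos (integrable_comp_shift (h.heatReg_exp hK m).cont (h.growth_exp hK m) i b c p)

lemma Reg.integrable_tilt (h : Reg K U Ut U1 U2) (hK : IsCompact K) (m : ℝ) (i : ι)
    (b c : ℝ) (p : ℝ × (ι → ℝ)) {f : ℝ × (ι → ℝ) → ℝ} (hf : Continuous f)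
    (hb : ∃ B, ∀ p, |f p| ≤ B) :
    Integrable (fun g => f (shift i b c p g)) (tilt m i b c U p) := by
  have := h.isProbabilityMeasure_tilt hK m i b c p
  obtain ⟨B, hB⟩ := hb
  exact Integrable.of_bound (hf.comp (continuous_shift_right i b c p)).aestronglyMeasurable B
    (Eventually.of_forall fun g => hB _)

lemma Reg.abs_wavg_le (h : Reg K U Ut U1 U2) (hK : IsCompact K) (m : ℝ) (i : ι)
    (b c : ℝ) (p : ℝ × (ι → ℝ)) {f : ℝ × (ι → ℝ) → ℝ} {B : ℝ} (hB : ∀ p, |f p| ≤ B) :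
    |wavg m i b c U f p| ≤ B := by
  have := h.isProbabilityMeasure_tilt hK m i b c p
  simpa [wavg] using norm_integral_le_of_norm_le_const (μ := tilt m i b c U p)
    (f := fun g => f (shift i b c p g)) (Eventually.of_forall fun g => hB (shift i b c p g))

lemma Reg.continuous_wavg (h : Reg K U Ut U1 U2) (hK : IsCompact K) (m : ℝ) (i : ι)
    (b c : ℝ) {f : ℝ × (ι → ℝ) → ℝ} (hf : Continuous f) (hb : ∃ B, ∀ p, |f p| ≤ B) :
    Continuous (wavg m i b c U f) := by
  have e : wavg m i b c U f = _ := funext (wavg_eq m i b c U f)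
  rw [e]
  have hE := (h.heatReg_exp hK m).cont
  obtain ⟨B, hB⟩ := hb
  exact (continuous_smooth (hf.mul hE)
    (ExpGrowth.mul (ExpGrowth.of_bounded hB) (h.growth_exp hK m)) i b c).div
    (continuous_smooth hE (h.growth_exp hK m) i b c) fun p => (h.smooth_exp_pos hK m i b c p).ne'

omit [Fintype ι] in
lemma smooth_const_mul (i : ι) (b c a : ℝ) (f : ℝ × (ι → ℝ) → ℝ) (p : ℝ × (ι → ℝ)) :
    smooth i b c (fun p => a * f p) p = a * smooth i b c f p :=
  integral_const_mul _ _

/-- Cole–Hopf: the logarithm of a heat average has tilted averages as derivatives. The second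
derivative is arranged so that adding `m` times the squared first derivative gives back exactly the
tilted average of `∂_j² U + m (∂_j U)²`. The case `m = 0` is plain heat flow and is separate only
because of the factor `1 / m`. -/
lemma Reg.hasDerivs_smoothLog (h : Reg K U Ut U1 U2) (hK : IsCompact K) (m : ℝ) (i : ι)
    (b c : ℝ) :
    HasDerivs (smoothLog m i b c U)
      (fun p => wavg m i b c U Ut p + amp b c p.1 * ampDeriv b c p.1
        * wavg m i b c U (fun p => U2 i p + m * U1 i p ^ 2) p)
      (fun j => wavg m i b c U (U1 j))
      (fun j p => wavg m i b c U (fun p => U2 j p + m * U1 j p ^ 2) p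
        - m * wavg m i b c U (U1 j) p ^ 2) := by
  have c1 := fun j => h.continuous_wavg hK m i b c (h.cont1 j)
    (⟨_, (h.bdd1 hK).choose_spec j⟩)
  have c2 := fun j => h.continuous_wavg hK m i b c (f := fun p => U2 j p + m * U1 j p ^ 2)
    (by have := h.cont1 j; have := h.cont2 j; fun_prop) (h.bdd_mix hK m j)
  have ct := h.continuous_wavg hK m i b c h.cont_t h.bdd_t
  have ca := continuous_amp b c
  have ca' := continuous_ampDeriv b c
  refine ⟨fun p => ?_, fun j p => ?_, ?_, c1, fun j => ?_⟩
  · rcases eq_or_ne m 0 with rfl | hm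
    · have := ((h.heatReg hK).smooth i b c).hasFDerivAt p
      simp only [wavg_zero, zero_mul, add_zero]
      convert this using 1
      ext q
      simp [smoothLog, logMean, SK.smooth]
    · have hM := h.smooth_exp_pos hK m i b c
      have := (((((h.heatReg_exp hK m).smooth i b c).hasFDerivAt p).log
        (hM p).ne').const_mul (1 / m))
      have e : smoothLog m i b c U = fun p => 1 / m *
          Real.log (smooth i b c (fun p => Real.exp (m * U p)) p) := by
        ext q; simp [smoothLog, logMean, SK.smooth, hm]
      rw [e]
      refine this.congr_fderiv ?_
      have hM' := (hM p).ne'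
      simp only [wavg_eq, smooth_const_mul]
      ext v
      · simp
        field_simp
      · simp only [ContinuousLinearMap.comp_apply, ContinuousLinearMap.inr_apply, fd_apply,
          _root_.smul_apply, smul_eq_mul, mul_zero, zero_add, Finset.mul_sum]
        exact Finset.sum_congr rfl fun j _ => by field_simp
  · rcases eq_or_ne m 0 with rfl | hm
    · have := ((h.heatReg hK).smooth i b c).second j p
      simpa only [wavg_zero, zero_mul, add_zero, sub_zero] using this
    · have hM := h.smooth_exp_pos hK m i b c
      have h0 : (p.1, p.2 + Pi.single j (0 : ℝ)) = p := by simp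
      have H := (h.heatReg_exp hK m).smooth i b c
      have s1 := H.second j p
      have s2 : HasDerivAt (fun s : ℝ => smooth i b c (fun p => Real.exp (m * U p))
          (p.1, p.2 + Pi.single j s)) (m * smooth i b c (fun p => U1 j p * Real.exp (m * U p)) p)
          0 := by
        have e : HasDerivAt (fun s : ℝ => ((p.1, p.2 + Pi.single j s) : ℝ × (ι → ℝ)))
            ((0 : ℝ), Pi.single j (1 : ℝ)) 0 :=
          (hasDerivAt_const _ _).prodMk ((hasDerivAt_single j (0 : ℝ)).const_add p.2)
        have := HasFDerivAt.comp_hasDerivAt (0 : ℝ) (by simpa [h0] using H.hasFDerivAt p) e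
        refine this.congr_deriv ?_
        simp [Pi.single_apply, smooth_const_mul]
      have s3 := (s1.div s2 (by simpa [h0] using (hM p).ne')).const_mul (1 / m)
      simp only [wavg_eq]
      refine (s3.congr_of_eventuallyEq (Eventually.of_forall fun s => ?_)).congr_deriv ?_
      · simp only [Pi.div_apply, smooth_const_mul]
        field_simp
      · simp only [h0, smooth_const_mul]
        have hM' := (hM p).ne'
        field_simp
  · fun_prop
  · have := c1 j
    have := c2 j
    fun_prop

lemma Reg.smoothLog (h : Reg K U Ut U1 U2) (hK : IsCompact K) (hKc : Convex ℝ K) (m : ℝ) (i : ι)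
    (b c : ℝ) :
    Reg K (smoothLog m i b c U)
      (fun p => wavg m i b c U Ut p + amp b c p.1 * ampDeriv b c p.1
        * wavg m i b c U (fun p => U2 i p + m * U1 i p ^ 2) p)
      (fun j => wavg m i b c U (U1 j))
      (fun j p => wavg m i b c U (fun p => U2 j p + m * U1 j p ^ 2) p
        - m * wavg m i b c U (U1 j) p ^ 2) where
  toHasDerivs := h.hasDerivs_smoothLog hK m i b c
  bdd_t := by
    obtain ⟨B, hB⟩ := h.bdd_t
    obtain ⟨D, hD⟩ := h.bdd_mix hK m i
    refine ⟨B + (|b| + |c|) * (|b| + |c|) * D, fun p => (abs_add_le _ _).trans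
      (add_le_add (h.abs_wavg_le hK m i b c p hB) ?_)⟩
    rw [abs_mul, abs_mul]
    exact mul_le_mul (mul_le_mul (abs_amp_le _ _ _) (abs_ampDeriv_le _ _ _) (abs_nonneg _)
      (by positivity)) (h.abs_wavg_le hK m i b c p hD) (abs_nonneg _) (by positivity)
  bdd2 := fun j => by
    obtain ⟨V, hV⟩ := h.bdd1 hK
    obtain ⟨D, hD⟩ := h.bdd_mix hK m j
    refine ⟨D + |m| * V ^ 2, fun p => (abs_sub _ _).trans
      (add_le_add (h.abs_wavg_le hK m i b c p hD) ?_)⟩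
    rw [abs_mul, abs_pow]
    gcongr
    exact h.abs_wavg_le hK m i b c p (hV j)
  mem := fun p => by
    have := h.isProbabilityMeasure_tilt hK m i b c p
    have hi : ∀ j, Integrable (fun g => U1 j (shift i b c p g)) (tilt m i b c U p) := fun j =>
      h.integrable_tilt hK m i b c p (h.cont1 j) ⟨_, (h.bdd1 hK).choose_spec j⟩
    -- The new gradient is the barycentre of old gradients under a probability measure, so a closed
    -- convex set containing the old ones contains it.
    have key := hKc.integral_mem hK.isClosed (μ := tilt m i b c U p)
      (f := fun g j => U1 j (shift i b c p g)) (Eventually.of_forall fun g => h.mem _)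
      (Integrable.of_eval hi)
    convert key using 1
    ext j
    rw [eval_integral hi]
    rfl

/-- A regular function satisfying, on `[0, π/2]`, the differential inequality
`∂_θ U + sin θ cos θ ∑ ρ_i (∂_i² U + m (∂_i U)²) ≤ κ sin θ cos θ`. -/
def Flow (K : Set (ι → ℝ)) (m : ℝ) (ρ : ι → ℝ) (κ : ℝ) (U : ℝ × (ι → ℝ) → ℝ) : Prop :=
  ∃ Ut U1 U2, Reg K U Ut U1 U2 ∧ ∀ p, 0 ≤ p.1 → p.1 ≤ Real.pi / 2 →
    Ut p + Real.sin p.1 * Real.cos p.1 * ∑ j, ρ j * (U2 j p + m * U1 j p ^ 2)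
      ≤ Real.sin p.1 * Real.cos p.1 * κ

/-- The hypothesis is averaged under the tilted law at fixed θ. Each term averages to its
counterpart for the new function, except that the θ-derivative has gained the amplitude term in
direction `i`; removing `b² - c²` from `ρ_i` compensates for it. -/
lemma Flow.smoothLog {m κ : ℝ} {ρ : ι → ℝ} (h : Flow K m ρ κ U) (hK : IsCompact K)
    (hKc : Convex ℝ K) (i : ι) {b c : ℝ} (hbc : b * c = 0) :
    Flow K m (ρ - Pi.single i (b ^ 2 - c ^ 2)) κ (smoothLog m i b c U) := by
  obtain ⟨Ut, U1, U2, hR, hle⟩ := h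
  refine ⟨_, _, _, hR.smoothLog hK hKc m i b c, fun p h0 h1 => ?_⟩
  have := hR.isProbabilityMeasure_tilt hK m i b c p
  set s := Real.sin p.1 * Real.cos p.1 with hs
  have it := hR.integrable_tilt hK m i b c p hR.cont_t hR.bdd_t
  have i2 := fun j => hR.integrable_tilt hK m i b c p (f := fun p => U2 j p + m * U1 j p ^ 2)
    (by have := hR.cont1 j; have := hR.cont2 j; fun_prop) (hR.bdd_mix hK m j)
  have is : Integrable (fun g => ∑ j, ρ j * (U2 j (shift i b c p g)
      + m * U1 j (shift i b c p g) ^ 2)) (tilt m i b c U p) :=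
    integrable_finsetSum _ fun j _ => (i2 j).const_mul _
  have key : ∫ g, (Ut (shift i b c p g) + s * ∑ j, ρ j * (U2 j (shift i b c p g)
      + m * U1 j (shift i b c p g) ^ 2)) ∂(tilt m i b c U p) ≤ ∫ _g, s * κ ∂(tilt m i b c U p) :=
    integral_mono (it.add (is.const_mul _)) (integrable_const _)
      fun g => hle (shift i b c p g) h0 h1
  rw [integral_add it (is.const_mul _), integral_const_mul,
    integral_finsetSum _ fun j _ => (i2 j).const_mul _] at key
  simp only [integral_const_mul, integral_const, probReal_univ, one_smul] at key
  refine le_trans (le_of_eq ?_) key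
  rw [amp_mul_ampDeriv hbc, ← hs]
  simp only [sub_add_cancel, Pi.sub_apply, sub_mul, Finset.sum_sub_distrib, Pi.single_apply,
    ite_mul, zero_mul, Finset.sum_ite_eq', Finset.mem_univ, if_true, wavg]
  ring

/-- Passing from `m` to `m'` removes `(m - m') ∑ ρ_j (∂_j U)²`, which is at least `-(m - m') d`
since the gradient lies in `K`. The weights `ρ` may have either sign. -/
lemma Flow.weaken {m m' κ d : ℝ} {ρ : ι → ℝ} (h : Flow K m ρ κ U) (hm : m' ≤ m)
    (hd : ∀ x ∈ K, -d ≤ ∑ j, ρ j * x j ^ 2) : Flow K m' ρ (κ + (m - m') * d) U := by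
  obtain ⟨Ut, U1, U2, hR, hle⟩ := h
  refine ⟨_, _, _, hR, fun p h0 h1 => ?_⟩
  have hs : 0 ≤ Real.sin p.1 * Real.cos p.1 :=
    mul_nonneg (Real.sin_nonneg_of_nonneg_of_le_pi h0 (by linarith [Real.pi_pos]))
      (Real.cos_nonneg_of_neg_pi_div_two_le_of_le (by linarith [Real.pi_pos]) h1)
  have h2 := hd _ (hR.mem p)
  have e : ∑ j, ρ j * (U2 j p + m' * U1 j p ^ 2)
      = ∑ j, ρ j * (U2 j p + m * U1 j p ^ 2) - (m - m') * ∑ j, ρ j * U1 j p ^ 2 := by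
    rw [Finset.mul_sum, ← Finset.sum_sub_distrib]
    exact Finset.sum_congr rfl fun j _ => by ring
  rw [e]
  nlinarith [hle p h0 h1, mul_nonneg hs (mul_nonneg (sub_nonneg.2 hm) (by linarith [h2] :
    0 ≤ d + ∑ j, ρ j * U1 j p ^ 2))]

/-- The flow inequality integrated over `[0, π/2]` for functions of `θ` only. -/
lemma Flow.le_at_zero {κ : ℝ} (h : Flow K 0 (0 : ι → ℝ) κ U) (x : ι → ℝ) :
    U (Real.pi / 2, x) ≤ U (0, x) + κ / 2 := by
  obtain ⟨Ut, U1, U2, hR, hle⟩ := h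
  -- `(κ / 2) sin² θ` is a primitive of the right-hand side; its increment over `[0, π/2]` is the `κ
  -- / 2` of the conclusion.
  have hd : ∀ θ, HasDerivAt (fun θ => U (θ, x) - κ / 2 * Real.sin θ ^ 2)
      (Ut (θ, x) - κ / 2 * (2 * Real.sin θ * Real.cos θ)) θ := fun θ => by
    have e : HasDerivAt (fun s : ℝ => ((s, x) : ℝ × (ι → ℝ))) ((1 : ℝ), (0 : ι → ℝ)) θ :=
      (hasDerivAt_id θ).prodMk (hasDerivAt_const _ _)
    have h1 := (hR.hasFDerivAt (θ, x)).comp_hasDerivAt θ e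
    have h2 := ((Real.hasDerivAt_sin θ).pow 2).const_mul (κ / 2)
    refine (h1.sub h2).congr_deriv ?_
    simp
  have hanti : AntitoneOn (fun θ => U (θ, x) - κ / 2 * Real.sin θ ^ 2)
      (Set.Icc 0 (Real.pi / 2)) := by
    refine antitoneOn_of_deriv_nonpos (convex_Icc _ _)
      (fun θ _ => (hd θ).continuousAt.continuousWithinAt)
      (fun θ _ => (hd θ).differentiableAt.differentiableWithinAt) fun θ hθ => ?_
    rw [interior_Icc] at hθ
    rw [(hd θ).deriv]
    have := hle (θ, x) hθ.1.le hθ.2.le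
    simp at this
    linarith
  have hp : (0 : ℝ) ≤ Real.pi / 2 := by positivity
  have := hanti (Set.left_mem_Icc.2 hp) (Set.right_mem_Icc.2 hp) hp
  simp at this
  linarith

end Flow

/-! ### Log-sum-exp as starting point of the flow -/

section LogSumExp

variable {ι : Type*} [Fintype ι] [DecidableEq ι] {S : Type*} [Fintype S] [Nonempty S]

/-- `log ∑_σ exp ⟨v_σ, x⟩`, as a function of `(θ, x)` not depending on `θ`. -/
noncomputable def logSumExp (v : S → ι → ℝ) (p : ℝ × (ι → ℝ)) : ℝ :=
  Real.log (∑ σ, Real.exp (∑ j, v σ j * p.2 j))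

/-- The average of `f` for the Gibbs measure with weights `exp ⟨v_σ, x⟩`. -/
noncomputable def gibbs (v : S → ι → ℝ) (f : S → ℝ) (p : ℝ × (ι → ℝ)) : ℝ :=
  (∑ σ, f σ * Real.exp (∑ j, v σ j * p.2 j)) / ∑ σ, Real.exp (∑ j, v σ j * p.2 j)

omit [DecidableEq ι] in
lemma sum_exp_pos (v : S → ι → ℝ) (p : ℝ × (ι → ℝ)) :
    0 < ∑ σ, Real.exp (∑ j, v σ j * p.2 j) :=
  Finset.sum_pos (fun _ _ => Real.exp_pos _) Finset.univ_nonempty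

omit [DecidableEq ι] in
lemma continuous_gibbs (v : S → ι → ℝ) (f : S → ℝ) : Continuous (gibbs v f) :=
  Continuous.div (by fun_prop) (by fun_prop) fun p => (sum_exp_pos v p).ne'

omit [DecidableEq ι] in
lemma gibbs_mono (v : S → ι → ℝ) {f h : S → ℝ} (hfh : ∀ σ, f σ ≤ h σ) (p : ℝ × (ι → ℝ)) :
    gibbs v f p ≤ gibbs v h p :=
  div_le_div_of_nonneg_right (Finset.sum_le_sum fun σ _ =>
    mul_le_mul_of_nonneg_right (hfh σ) (Real.exp_pos _).le) (sum_exp_pos v p).le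

omit [DecidableEq ι] in
lemma gibbs_const (v : S → ι → ℝ) (a : ℝ) (p : ℝ × (ι → ℝ)) :
    gibbs v (fun _ => a) p = a := by
  rw [gibbs, ← Finset.mul_sum, mul_div_assoc, div_self (sum_exp_pos v p).ne', mul_one]

omit [DecidableEq ι] in
lemma abs_gibbs_le (v : S → ι → ℝ) {f : S → ℝ} {B : ℝ} (hB : ∀ σ, |f σ| ≤ B)
    (p : ℝ × (ι → ℝ)) : |gibbs v f p| ≤ B := by
  rw [abs_le]
  constructor
  · have := gibbs_mono v (f := fun _ => -B) (h := f) (fun σ => (abs_le.1 (hB σ)).1) p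
    rwa [gibbs_const] at this
  · have := gibbs_mono v (h := fun _ => B) (f := f) (fun σ => (abs_le.1 (hB σ)).2) p
    rwa [gibbs_const] at this

omit [DecidableEq ι] in
lemma gibbs_mem (v : S → ι → ℝ) (p : ℝ × (ι → ℝ)) :
    (fun j => gibbs v (fun σ => v σ j) p) ∈ convexHull ℝ (Set.range v) := by
  have hZ := sum_exp_pos v p
  have h := (convex_convexHull ℝ (Set.range v)).sum_mem (t := Finset.univ)
    (w := fun σ => Real.exp (∑ j, v σ j * p.2 j) / ∑ σ, Real.exp (∑ j, v σ j * p.2 j))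
    (z := v) (fun σ _ => by positivity) (by rw [← Finset.sum_div, div_self hZ.ne'])
    (fun σ _ => subset_convexHull ℝ _ ⟨σ, rfl⟩)
  convert h using 1
  ext j
  simp only [gibbs, Finset.sum_apply, Pi.smul_apply, smul_eq_mul, Finset.sum_div]
  exact Finset.sum_congr rfl fun σ _ => by ring

omit [Fintype ι] [DecidableEq ι] [Nonempty S] in
lemma exists_abs_le (f : S → ℝ) : ∃ B, ∀ σ, |f σ| ≤ B :=
  ⟨∑ σ, |f σ|, fun σ => Finset.single_le_sum (f := fun σ => |f σ|)
    (fun _ _ => abs_nonneg _) (Finset.mem_univ σ)⟩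

lemma reg_logSumExp (v : S → ι → ℝ) :
    Reg (convexHull ℝ (Set.range v)) (logSumExp v) (fun _ => 0)
      (fun j => gibbs v fun σ => v σ j)
      (fun j p => gibbs v (fun σ => v σ j ^ 2) p - gibbs v (fun σ => v σ j) p ^ 2) where
  hasFDerivAt := fun p => by
    have e : ∀ σ, HasFDerivAt (fun p : ℝ × (ι → ℝ) => ∑ j, v σ j * p.2 j) (fd 0 (v σ)) p := by
      intro σ
      refine ((fd 0 (v σ)).hasFDerivAt (x := p)).congr_of_eventuallyEq
        (Eventually.of_forall fun q => ?_)
      simp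
    have h := (HasFDerivAt.fun_sum fun σ (_ : σ ∈ Finset.univ) => (e σ).exp).log
      (sum_exp_pos v p).ne'
    refine h.congr_fderiv ?_
    ext w
    · simp
    · simp only [ContinuousLinearMap.comp_apply, ContinuousLinearMap.inr_apply, fd_apply,
          _root_.smul_apply, smul_eq_mul, mul_zero, zero_add, _root_.sum_apply, gibbs,
          Finset.mul_sum, Finset.sum_div, Finset.sum_mul]
      rw [Finset.sum_comm]
      exact Finset.sum_congr rfl fun j _ => Finset.sum_congr rfl fun σ _ => by ring
  second := fun j p => by
    have h0 : p.2 + Pi.single j (0 : ℝ) = p.2 := by simp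
    have e : ∀ σ, HasDerivAt (fun s : ℝ => Real.exp (∑ l, v σ l * (p.2 + Pi.single j s : ι → ℝ) l))
        (v σ j * Real.exp (∑ l, v σ l * p.2 l)) 0 := by
      intro σ
      have h1 : HasDerivAt (fun s : ℝ => (∑ l, v σ l * p.2 l) + v σ j * s) (v σ j) 0 := by
        simpa using ((hasDerivAt_id (0 : ℝ)).const_mul (v σ j)).const_add (∑ l, v σ l * p.2 l)
      have h2 := h1.exp
      refine (h2.congr_of_eventuallyEq (Eventually.of_forall fun s => ?_)).congr_deriv ?_
      · simp [mul_add, Finset.sum_add_distrib, Pi.single_apply]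
      · simp; ring
    have n := HasDerivAt.fun_sum fun σ (_ : σ ∈ Finset.univ) => (e σ).const_mul (v σ j)
    have d := HasDerivAt.fun_sum fun σ (_ : σ ∈ Finset.univ) => e σ
    have hZ := (sum_exp_pos v p).ne'
    refine (n.div d (by simpa [h0] using hZ)).congr_deriv ?_
    simp only [h0, gibbs]
    have e2 : ∑ σ, v σ j * (v σ j * Real.exp (∑ l, v σ l * p.2 l))
        = ∑ σ, v σ j ^ 2 * Real.exp (∑ l, v σ l * p.2 l) :=
      Finset.sum_congr rfl fun σ _ => by ring
    rw [e2]
    field_simp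
  cont_t := continuous_const
  cont1 := fun j => continuous_gibbs v _
  cont2 := fun j => (continuous_gibbs v _).sub ((continuous_gibbs v _).pow 2)
  bdd_t := ⟨0, fun _ => by simp⟩
  bdd2 := fun j => by
    obtain ⟨V, hV⟩ := exists_abs_le fun σ => v σ j
    obtain ⟨D, hD⟩ := exists_abs_le fun σ => v σ j ^ 2
    refine ⟨D + V ^ 2, fun p => (abs_sub _ _).trans (add_le_add (abs_gibbs_le v hD p) ?_)⟩
    rw [abs_pow]
    gcongr
    exact abs_gibbs_le v hV p
  mem := gibbs_mem v

/-- At `m = 1` the squared Gibbs mean cancels from the variance, so the bracket is the Gibbs average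
of `v_σj²` and only the diagonal of the covariance matters. -/
lemma flow_logSumExp (v : S → ι → ℝ) {ρ : ι → ℝ} {κ : ℝ}
    (h : ∀ σ, ∑ j, ρ j * v σ j ^ 2 ≤ κ) :
    Flow (convexHull ℝ (Set.range v)) 1 ρ κ (logSumExp v) := by
  refine ⟨_, _, _, reg_logSumExp v, fun p h0 h1 => ?_⟩
  have hs : 0 ≤ Real.sin p.1 * Real.cos p.1 :=
    mul_nonneg (Real.sin_nonneg_of_nonneg_of_le_pi h0 (by linarith [Real.pi_pos]))
      (Real.cos_nonneg_of_neg_pi_div_two_le_of_le (by linarith [Real.pi_pos]) h1)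
  rw [zero_add]
  refine mul_le_mul_of_nonneg_left ?_ hs
  have h2 := gibbs_mono v h p
  rw [gibbs_const] at h2
  refine le_trans (le_of_eq ?_) h2
  simp only [one_mul, sub_add_cancel, gibbs, Finset.sum_mul, ← mul_div_assoc, Finset.mul_sum]
  rw [← Finset.sum_div, Finset.sum_comm]
  simp only [mul_assoc]

omit [Fintype S] [Nonempty S] [DecidableEq ι] in
/-- A lower bound on a bilinear form over pairs of extreme points extends to the convex hull. -/
lemma le_quadratic_of_mem_convexHull {v : S → ι → ℝ} {ρ : ι → ℝ} {d : ℝ}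
    (h : ∀ σ τ, d ≤ ∑ j, ρ j * (v σ j * v τ j)) {x : ι → ℝ}
    (hx : x ∈ convexHull ℝ (Set.range v)) : d ≤ ∑ j, ρ j * x j ^ 2 := by
  -- The quadratic form is indefinite, so its superlevel sets need not be convex; the bilinear form
  -- is linear in each argument, and the hull is taken in one argument at a time.
  have lin : ∀ y : ι → ℝ, Convex ℝ {x : ι → ℝ | d ≤ ∑ j, ρ j * (x j * y j)} := fun y =>
    convex_halfSpace_ge (𝕜 := ℝ) (f := fun x : ι → ℝ => ∑ j, ρ j * (x j * y j))
      ⟨fun a b => by simp [add_mul, mul_add, Finset.sum_add_distrib],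
        fun a b => by
          simp only [Pi.smul_apply, smul_eq_mul, Finset.mul_sum]
          exact Finset.sum_congr rfl fun j _ => by ring⟩ d
  have h1 : ∀ τ, d ≤ ∑ j, ρ j * (x j * v τ j) := fun τ =>
    convexHull_min (by rintro _ ⟨σ, rfl⟩; exact h σ τ) (lin (v τ)) hx
  have h2 : d ≤ ∑ j, ρ j * (x j * x j) :=
    convexHull_min (s := Set.range v)
      (by rintro _ ⟨τ, rfl⟩; simpa only [Set.mem_ofPred_eq, mul_comm (v τ _)] using h1 τ) (lin x) hx
  simpa only [sq] using h2

end LogSumExp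

/-! ### Iterated averaging and integration of the flow -/

section Iterate

variable {ι : Type*} [Fintype ι] [DecidableEq ι]

/-- Successive application of `smoothLog m` to the coordinates in a list. -/
noncomputable def smoothLogs (m : ℝ) (b c : ι → ℝ) (l : List ι) (U : ℝ × (ι → ℝ) → ℝ) :
    ℝ × (ι → ℝ) → ℝ :=
  l.foldr (fun i U => smoothLog m i (b i) (c i) U) U

lemma Flow.smoothLogs {K : Set (ι → ℝ)} {U : ℝ × (ι → ℝ) → ℝ} {m κ : ℝ} {ρ : ι → ℝ}
    (h : Flow K m ρ κ U) (hK : IsCompact K) (hKc : Convex ℝ K) {b c : ι → ℝ}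
    (hbc : ∀ i, b i * c i = 0) (l : List ι) :
    Flow K m (ρ - (l.map fun i => Pi.single i (b i ^ 2 - c i ^ 2)).sum) κ
      (smoothLogs m b c l U) := by
  induction l with
  | nil => simpa [SK.smoothLogs] using h
  | cons i l ih =>
    have := ih.smoothLog hK hKc i (hbc i)
    rw [sub_sub, add_comm] at this
    simpa [SK.smoothLogs] using this

/-- The law of i.i.d. standard Gaussian variables. -/
noncomputable abbrev gaussianPi (ι : Type*) [Fintype ι] : Measure (ι → ℝ) :=
  Measure.pi fun _ : ι => gaussianReal 0 1

lemma measurePreserving_update_gaussianPi (i : ι) :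
    MeasurePreserving (fun q : ℝ × (ι → ℝ) => Function.update q.2 i q.1)
      ((gaussianReal 0 1).prod (gaussianPi ι)) (gaussianPi ι) := by
  have hm : Measurable fun q : ℝ × (ι → ℝ) => Function.update q.2 i q.1 := by
    refine measurable_pi_iff.2 fun j => ?_
    rcases eq_or_ne j i with rfl | hj
    · simpa using measurable_fst
    · simp only [Function.update_of_ne hj]; fun_prop
  refine ⟨hm, (Measure.pi_eq fun s hs => ?_).symm⟩
  rw [Measure.map_apply hm (MeasurableSet.univ_pi hs)]
  have e : (fun q : ℝ × (ι → ℝ) => Function.update q.2 i q.1) ⁻¹' Set.univ.pi s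
      = s i ×ˢ Set.univ.pi (Function.update s i Set.univ) := by
    ext q
    simp only [Set.mem_preimage, Set.mem_univ_pi, Set.mem_prod]
    constructor
    · refine fun h => ⟨by simpa using h i, fun j => ?_⟩
      rcases eq_or_ne j i with rfl | hj
      · simp
      · simpa [hj] using h j
    · rintro ⟨h1, h2⟩ j
      rcases eq_or_ne j i with rfl | hj
      · simpa using h1
      · simpa [hj] using h2 j
  rw [e, Measure.prod_prod, Measure.pi_pi, ← Finset.mul_prod_erase Finset.univ _ (Finset.mem_univ i),
    ← Finset.mul_prod_erase Finset.univ (fun j => gaussianReal 0 1 (s j)) (Finset.mem_univ i)]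
  simp only [Function.update_self, measure_univ, one_mul]
  congr 1
  refine Finset.prod_congr rfl fun j hj => ?_
  rw [Function.update_of_ne (Finset.ne_of_mem_erase hj)]

omit [DecidableEq ι] in
lemma integrable_gaussianPi {f : (ι → ℝ) → ℝ} (hc : Continuous f) (hf : ExpGrowth f) :
    Integrable f (gaussianPi ι) := by
  obtain ⟨C, c, hC, hc', H⟩ := hf
  have h1 : Integrable (fun g : ι → ℝ => ∏ i, 1 * Real.exp (c * |g i|)) (gaussianPi ι) :=
    Integrable.fintype_prod fun i => integrable_exp_abs 1 c
  refine (h1.const_mul C).mono' hc.aestronglyMeasurable (Eventually.of_forall fun g => ?_)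
  refine (H g).trans (mul_le_mul_of_nonneg_left ?_ hC)
  simp only [one_mul]
  rw [← Real.exp_sum, ← Finset.mul_sum]
  refine Real.exp_le_exp.2 (mul_le_mul_of_nonneg_left ?_ hc')
  refine (pi_norm_le_iff_of_nonneg (Finset.sum_nonneg fun _ _ => abs_nonneg _)).2 fun i => ?_
  exact Finset.single_le_sum (f := fun i => |g i|) (fun _ _ => abs_nonneg _) (Finset.mem_univ i)

/-- Average over a Gaussian perturbation, of amplitude `a i`, of coordinate `i`. -/
noncomputable def avg (a : ι → ℝ) (i : ι) (f : (ι → ℝ) → ℝ) (x : ι → ℝ) : ℝ :=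
  ∫ g, f (x + Pi.single i (a i * g)) ∂(gaussianReal 0 1)

/-- The Gaussian perturbation of the coordinates in a list. -/
def perturb (a : ι → ℝ) (l : List ι) (x g : ι → ℝ) : ι → ℝ :=
  fun i => x i + if i ∈ l then a i * g i else 0

omit [Fintype ι] in
lemma continuous_perturb (a : ι → ℝ) (l : List ι) (x : ι → ℝ) : Continuous (perturb a l x) := by
  refine continuous_pi fun i => ?_
  by_cases h : i ∈ l
  · simp only [perturb, h, if_true]; fun_prop
  · simp only [perturb, h, if_false]; fun_prop

lemma ExpGrowth.comp_perturb {f : (ι → ℝ) → ℝ} (h : ExpGrowth f) (a : ι → ℝ) (l : List ι)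
    (x : ι → ℝ) : ExpGrowth fun g => f (perturb a l x g) := by
  obtain ⟨C, c, hC, hc, H⟩ := h
  refine ⟨C * Real.exp (c * ‖x‖), c * ‖a‖, by positivity, by positivity, fun g => (H _).trans ?_⟩
  rw [mul_assoc C, ← Real.exp_add]
  refine mul_le_mul_of_nonneg_left (Real.exp_le_exp.2 ?_) hC
  have : ‖perturb a l x g‖ ≤ ‖x‖ + ‖a‖ * ‖g‖ := by
    refine (pi_norm_le_iff_of_nonneg (by positivity)).2 fun i => (norm_add_le _ _).trans
      (add_le_add (norm_le_pi_norm x i) ?_)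
    split_ifs
    · rw [norm_mul]
      exact mul_le_mul (norm_le_pi_norm a i) (norm_le_pi_norm g i) (norm_nonneg _) (norm_nonneg _)
    · rw [norm_zero]; positivity
  nlinarith [mul_le_mul_of_nonneg_left this hc]

/-- Averaging successively over distinct coordinates is averaging over a Gaussian vector. -/
lemma foldr_avg {f : (ι → ℝ) → ℝ} (hc : Continuous f) (hf : ExpGrowth f) (a : ι → ℝ)
    {l : List ι} (hl : l.Nodup) (x : ι → ℝ) :
    l.foldr (avg a) f x = ∫ g, f (perturb a l x g) ∂(gaussianPi ι) := by
  induction l generalizing x with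
  | nil =>
    have e : ∀ g, perturb a [] x g = x := fun g => by ext; simp [perturb]
    simp [e]
  | cons i l ih =>
    have hi := (List.nodup_cons.1 hl).1
    have hmp := measurePreserving_update_gaussianPi i
    have hint : Integrable (fun g => f (perturb a (i :: l) x g)) (gaussianPi ι) :=
      integrable_gaussianPi (hc.comp (continuous_perturb _ _ _)) (hf.comp_perturb _ _ _)
    rw [List.foldr_cons, avg]
    -- Resampling coordinate `i` independently preserves the Gaussian law, and Fubini then isolates
    -- the outermost average. Distinctness of the list keeps the inner averages off coordinate `i`.
    conv_rhs => rw [← hmp.map_eq, integral_map hmp.measurable.aemeasurable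
      (by rw [hmp.map_eq]; exact hint.aestronglyMeasurable),
      integral_prod (fun q : ℝ × (ι → ℝ) => f (perturb a (i :: l) x (Function.update q.2 i q.1)))
        (hmp.integrable_comp_of_integrable hint)]
    congr 1
    ext s
    rw [ih (List.nodup_cons.1 hl).2]
    congr 1
    ext g
    congr 1
    ext j
    rcases eq_or_ne j i with rfl | hj
    · simp [perturb, hi]
    · simp [perturb, hj]

omit [Fintype ι] in
lemma smoothLogs_zero_eq_foldr_avg (b c : ι → ℝ) (l : List ι) (U : ℝ × (ι → ℝ) → ℝ) (θ : ℝ)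
    (x : ι → ℝ) :
    smoothLogs 0 b c l U (θ, x)
      = l.foldr (avg fun i => amp (b i) (c i) θ) (fun x => U (θ, x)) x := by
  induction l generalizing x with
  | nil => rfl
  | cons i l ih =>
    simp only [SK.smoothLogs, List.foldr_cons] at ih ⊢
    rw [smoothLog, avg, logMean, if_pos rfl]
    congr 1
    ext g
    exact ih _

omit [DecidableEq ι] in
lemma ExpGrowth.comp_mk {U : ℝ × (ι → ℝ) → ℝ} (h : ExpGrowth U) (θ : ℝ) :
    ExpGrowth fun x => U (θ, x) := by
  obtain ⟨C, c, hC, hc, H⟩ := h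
  refine ⟨C * Real.exp (c * |θ|), c, by positivity, hc, fun x => (H _).trans ?_⟩
  rw [mul_assoc C, ← Real.exp_add, ← mul_add]
  refine mul_le_mul_of_nonneg_left (Real.exp_le_exp.2 (mul_le_mul_of_nonneg_left ?_ hc)) hC
  rw [Prod.norm_def]
  exact max_le (le_add_of_nonneg_right (norm_nonneg _)) (le_add_of_nonneg_left (abs_nonneg _))

lemma smoothLogs_zero_univ {U : ℝ × (ι → ℝ) → ℝ} (hU : Continuous U) (hg : ExpGrowth U)
    (b c : ι → ℝ) (θ : ℝ) :
    smoothLogs 0 b c Finset.univ.toList U (θ, 0)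
      = ∫ g, U (θ, fun i => amp (b i) (c i) θ * g i) ∂(gaussianPi ι) := by
  rw [smoothLogs_zero_eq_foldr_avg,
    foldr_avg (f := fun x => U (θ, x)) (hU.comp (by fun_prop)) (hg.comp_mk θ) _ (Finset.nodup_toList _)]
  refine integral_congr_ae (Eventually.of_forall fun g => ?_)
  simp only
  congr 2
  ext i
  simp [perturb]

/-- The interpolation inequality between the two ends of a flow. -/
lemma Flow.integral_le {K : Set (ι → ℝ)} {U : ℝ × (ι → ℝ) → ℝ} {κ : ℝ} {ρ : ι → ℝ}
    (h : Flow K 0 ρ κ U) (hK : IsCompact K) (hKc : Convex ℝ K) {b c : ι → ℝ}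
    (hbc : ∀ i, b i * c i = 0) (hρ : ∀ i, ρ i = b i ^ 2 - c i ^ 2) :
    ∫ g, U (Real.pi / 2, fun i => b i * g i) ∂(gaussianPi ι)
      ≤ (∫ g, U (0, fun i => c i * g i) ∂(gaussianPi ι)) + κ / 2 := by
  have h1 := h.smoothLogs hK hKc hbc Finset.univ.toList
  have e : ρ - (Finset.univ.toList.map fun i => Pi.single i (b i ^ 2 - c i ^ 2)).sum = 0 := by
    rw [Finset.sum_map_toList, Finset.univ_sum_single, sub_eq_zero]
    exact funext hρ
  rw [e] at h1
  -- All of `ρ` is used up and `m = 0`, so both ends are ordinary Gaussian averages around the base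
  -- point 0, with amplitudes `b` at `π/2` and `c` at `0`.
  have h2 := h1.le_at_zero 0
  obtain ⟨_, _, _, hR, -⟩ := h
  rw [smoothLogs_zero_univ hR.cont (hR.growth hK),
    smoothLogs_zero_univ hR.cont (hR.growth hK)] at h2
  simpa [amp] using h2

end Iterate

lemma measurePreserving_comp_gaussianPi {ι κ : Type*} [Fintype ι] [Fintype κ] {e : κ → ι}
    (he : Function.Injective e) :
    MeasurePreserving (fun (g : ι → ℝ) j => g (e j)) (gaussianPi ι) (gaussianPi κ) := by
  refine ⟨by fun_prop, ?_⟩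
  have h1 : iIndepFun (fun (i : ι) (g : ι → ℝ) => g i) (gaussianPi ι) :=
    iIndepFun_pi (X := fun _ x => x) fun _ => aemeasurable_id
  have h2 := (iIndepFun_iff_map_fun_eq_pi_map (fun j =>
    (measurable_pi_apply (e j)).aemeasurable)).1 (h1.precomp he)
  rw [h2]
  congr 1
  ext1 j
  exact (measurePreserving_eval (fun _ : ι => gaussianReal 0 1) (e j)).map_eq

lemma integral_comp_gaussianPi {ι κ : Type*} [Fintype ι] [Fintype κ] {e : κ → ι}
    (he : Function.Injective e) {f : (κ → ℝ) → ℝ} (hf : Continuous f) :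
    ∫ g, f (fun j => g (e j)) ∂(gaussianPi ι) = ∫ g, f g ∂(gaussianPi κ) := by
  rw [← (measurePreserving_comp_gaussianPi he).map_eq,
    integral_map (measurePreserving_comp_gaussianPi he).measurable.aemeasurable
      hf.aestronglyMeasurable]

lemma isCompact_hull {ι S : Type*} [Finite S] (v : S → ι → ℝ) :
    IsCompact (convexHull ℝ (Set.range v)) :=
  (Set.finite_range v).isCompact_convexHull ℝ

/-! ### The SK Hamiltonian as a Gaussian linear form -/

section Spin

variable {n : ℕ}

/-- The real value of a spin. -/
def spin (σ : Fin n → ℤˣ) (i : Fin n) : ℝ := ((σ i : ℤ) : ℝ)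

lemma spin_mul_self (σ : Fin n → ℤˣ) (i : Fin n) : spin σ i * spin σ i = 1 := by
  unfold spin
  rcases Int.units_eq_one_or (σ i) with h | h <;> simp [h]

lemma abs_spin (σ : Fin n → ℤˣ) (i : Fin n) : |spin σ i| = 1 := by
  unfold spin
  rcases Int.units_eq_one_or (σ i) with h | h <;> simp [h]

/-- Coefficients of the Gaussian variables in `(β / 2) ⟨σ, W σ⟩`. -/
noncomputable def skVec (β : ℝ) (n : ℕ) (σ : Fin n → ℤˣ) (e : Fin n × Fin n) : ℝ :=
  β / √(2 * n) * (spin σ e.1 * spin σ e.2)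

/-- The unnormalised overlap `∑ i, σ_i τ_i`. -/
def overlap (σ τ : Fin n → ℤˣ) : ℝ := ∑ i, spin σ i * spin τ i

lemma overlap_self (σ : Fin n → ℤˣ) : overlap σ σ = n := by
  simp [overlap, spin_mul_self]

/-- The covariance of the Hamiltonian, which depends on the two configurations only through their
overlap. -/
lemma sum_skVec_mul (β : ℝ) (σ τ : Fin n → ℤˣ) :
    ∑ e, skVec β n σ e * skVec β n τ e = β ^ 2 / (2 * n) * overlap σ τ ^ 2 := by
  have h : (β / √(2 * n)) ^ 2 = β ^ 2 / (2 * n) := by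
    rw [div_pow, Real.sq_sqrt (by positivity)]
  rw [← h, Fintype.sum_prod_type, overlap, sq (∑ i, spin σ i * spin τ i), Finset.sum_mul_sum,
    Finset.mul_sum]
  refine Finset.sum_congr rfl fun i _ => ?_
  rw [Finset.mul_sum]
  refine Finset.sum_congr rfl fun j _ => ?_
  simp only [skVec]; ring

lemma sum_skVec_sq (β : ℝ) (σ : Fin n → ℤˣ) :
    ∑ e, skVec β n σ e ^ 2 = β ^ 2 / 2 * n := by
  simp only [sq (skVec β n σ _)]
  rw [sum_skVec_mul, overlap_self]
  rcases eq_or_ne (n : ℝ) 0 with h | h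
  · simp [h]
  · field_simp

/-- `log Z_n(β)` as a function of the Gaussian disorder. -/
noncomputable def freeEnergy (β : ℝ) (n : ℕ) (g : Fin n × Fin n → ℝ) : ℝ :=
  logSumExp (skVec β n) (0, g)

/-- `G` and its transpose contribute equally to the quadratic form, so the resulting factor 2
cancels the `1 / 2`. -/
lemma log_partition (β : ℝ) (G : Matrix (Fin n) (Fin n) ℝ) :
    Real.log (partition β (goe G)) = freeEnergy β n fun e => G e.1 e.2 := by
  unfold freeEnergy logSumExp partition
  congr 1
  refine Finset.sum_congr rfl fun σ _ => ?_
  congr 1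
  simp only [goe, Matrix.smul_apply, Matrix.add_apply, Matrix.transpose_apply, smul_eq_mul]
  have h1 : ∑ i, ∑ j, (√(2 * (n : ℝ)))⁻¹ * (G i j + G j i) * (((σ i : ℤ) : ℝ) * ((σ j : ℤ) : ℝ))
      = (∑ i, ∑ j, (√(2 * (n : ℝ)))⁻¹ * G i j * (spin σ i * spin σ j))
        + ∑ i, ∑ j, (√(2 * (n : ℝ)))⁻¹ * G j i * (spin σ j * spin σ i) := by
    rw [← Finset.sum_add_distrib]
    refine Finset.sum_congr rfl fun i _ => ?_
    rw [← Finset.sum_add_distrib]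
    refine Finset.sum_congr rfl fun j _ => ?_
    simp only [spin]; ring
  rw [h1, Finset.sum_comm (f := fun i j => (√(2 * (n : ℝ)))⁻¹ * G j i * (spin σ j * spin σ i)),
    Fintype.sum_prod_type, ← two_mul, ← mul_assoc, Finset.mul_sum]
  refine Finset.sum_congr rfl fun i _ => ?_
  rw [Finset.mul_sum]
  refine Finset.sum_congr rfl fun j _ => ?_
  simp only [skVec]; ring

lemma continuous_freeEnergy (β : ℝ) (n : ℕ) : Continuous (freeEnergy β n) :=
  (reg_logSumExp (skVec β n)).cont.comp (by fun_prop)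

lemma expGrowth_freeEnergy (β : ℝ) (n : ℕ) : ExpGrowth (freeEnergy β n) :=
  ((reg_logSumExp (skVec β n)).growth (isCompact_hull _)).comp_mk 0

/-- `E log Z_n(β)`. -/
noncomputable def meanFreeEnergy (β : ℝ) (n : ℕ) : ℝ :=
  ∫ g, freeEnergy β n g ∂(gaussianPi (Fin n × Fin n))

lemma meanFreeEnergy_zero (β : ℝ) : meanFreeEnergy β 0 = 0 := by
  simp [meanFreeEnergy, freeEnergy, logSumExp]

end Spin

/-! ### Superadditivity of the mean free energy -/

section Superadditive

/-- The coupled system of sizes `a + b`, `a` and `b`. -/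
noncomputable def splitVec (β : ℝ) (a b : ℕ) (σ : Fin (a + b) → ℤˣ) :
    (Fin (a + b) × Fin (a + b)) ⊕ ((Fin a × Fin a) ⊕ (Fin b × Fin b)) → ℝ :=
  Sum.elim (skVec β (a + b) σ)
    (Sum.elim (skVec β a fun i => σ (Fin.castAdd b i)) (skVec β b fun i => σ (Fin.natAdd a i)))

lemma sq_add_div_le {a b s t : ℝ} (ha : 0 < a) (hb : 0 < b) :
    (s + t) ^ 2 / (a + b) ≤ s ^ 2 / a + t ^ 2 / b := by
  rw [div_add_div _ _ ha.ne' hb.ne', div_le_div_iff₀ (by positivity) (by positivity)]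
  nlinarith [sq_nonneg (s * b - t * a)]

/-- The blocks carry weight `1` and are present at `π/2`; the union carries `-1` and is present at
`0`. Variances are proportional to size, so the diagonal cancels and `κ = 0`. The overlap of the
union is the sum of the block overlaps, so convexity of the square makes the covariance difference
nonnegative, and `m` drops from 1 to 0 at no cost. -/
lemma meanFreeEnergy_add_le_of_pos (β : ℝ) {a b : ℕ} (ha : 0 < a) (hb : 0 < b) :
    meanFreeEnergy β a + meanFreeEnergy β b ≤ meanFreeEnergy β (a + b) := by
  have ha' : (0 : ℝ) < a := by exact_mod_cast ha
  have hb' : (0 : ℝ) < b := by exact_mod_cast hb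
  have hK := isCompact_hull (splitVec β a b)
  have h1 : Flow (convexHull ℝ (Set.range (splitVec β a b))) 1
      (Sum.elim (fun _ => -1) fun _ => 1) 0 (logSumExp (splitVec β a b)) := by
    refine flow_logSumExp _ fun σ => le_of_eq ?_
    simp only [Fintype.sum_sum_type, Sum.elim_inl, Sum.elim_inr, splitVec, neg_mul, one_mul,
      Finset.sum_neg_distrib, sum_skVec_sq]
    push_cast; ring
  have h2 := h1.weaken zero_le_one (d := 0) fun x hx => by
    rw [neg_zero]
    refine le_quadratic_of_mem_convexHull (fun σ τ => ?_) hx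
    simp only [Fintype.sum_sum_type, Sum.elim_inl, Sum.elim_inr, splitVec, neg_mul, one_mul,
      Finset.sum_neg_distrib, sum_skVec_mul]
    have e : overlap σ τ = overlap (fun i => σ (Fin.castAdd b i)) (fun i => τ (Fin.castAdd b i))
        + overlap (fun i => σ (Fin.natAdd a i)) (fun i => τ (Fin.natAdd a i)) :=
      Fin.sum_univ_add _
    rw [e]
    have := mul_le_mul_of_nonneg_left (sq_add_div_le
      (s := overlap (fun i => σ (Fin.castAdd b i)) (fun i => τ (Fin.castAdd b i)))
      (t := overlap (fun i => σ (Fin.natAdd a i)) (fun i => τ (Fin.natAdd a i))) ha' hb')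
      (by positivity : 0 ≤ β ^ 2 / 2)
    push_cast
    calc (0 : ℝ) ≤ _ := sub_nonneg.2 this
      _ = _ := by field_simp; ring
  have h3 := h2.integral_le hK (convex_convexHull ℝ _)
    (b := Sum.elim (fun _ => 0) fun _ => 1) (c := Sum.elim (fun _ => 1) fun _ => 0)
    (by rintro (i | i) <;> simp) (by rintro (i | i) <;> simp)
  have eR : ∀ g : (Fin (a + b) × Fin (a + b)) ⊕ ((Fin a × Fin a) ⊕ (Fin b × Fin b)) → ℝ,
      logSumExp (splitVec β a b)
        (0, fun i => (Sum.elim (fun _ => 1) fun _ => 0 : _ → ℝ) i * g i)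
      = freeEnergy β (a + b) fun e => g (Sum.inl e) := fun g => by
    simp [logSumExp, freeEnergy, splitVec]
  have eL : ∀ g : (Fin (a + b) × Fin (a + b)) ⊕ ((Fin a × Fin a) ⊕ (Fin b × Fin b)) → ℝ,
      logSumExp (splitVec β a b)
        (Real.pi / 2, fun i => (Sum.elim (fun _ => 0) fun _ => 1 : _ → ℝ) i * g i)
      = freeEnergy β a (fun e => g (Sum.inr (Sum.inl e)))
        + freeEnergy β b (fun e => g (Sum.inr (Sum.inr e))) := fun g => by
    simp only [logSumExp, freeEnergy, splitVec, Fintype.sum_sum_type, Sum.elim_inl, Sum.elim_inr,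
      zero_mul, mul_zero, Finset.sum_const_zero, zero_add, one_mul, Real.exp_add]
    -- Without the joint Hamiltonian, the sum over configurations of the union factors over the two
    -- blocks.
    rw [← Real.log_mul (sum_exp_pos (skVec β a) (0, fun e => g (Sum.inr (Sum.inl e)))).ne'
      (sum_exp_pos (skVec β b) (0, fun e => g (Sum.inr (Sum.inr e)))).ne',
      ← (Fin.appendEquiv a b).sum_comp, Fintype.sum_prod_type, Finset.sum_mul_sum]
    simp [Fin.appendEquiv]
  simp only [eR, eL] at h3
  have ia : Integrable (fun g : (Fin (a + b) × Fin (a + b)) ⊕ ((Fin a × Fin a) ⊕ (Fin b × Fin b))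
      → ℝ => freeEnergy β a fun e => g (Sum.inr (Sum.inl e))) (gaussianPi _) :=
    (measurePreserving_comp_gaussianPi (Sum.inr_injective.comp
      Sum.inl_injective)).integrable_comp_of_integrable
      (integrable_gaussianPi (continuous_freeEnergy β a) (expGrowth_freeEnergy β a))
  have ib : Integrable (fun g : (Fin (a + b) × Fin (a + b)) ⊕ ((Fin a × Fin a) ⊕ (Fin b × Fin b))
      → ℝ => freeEnergy β b fun e => g (Sum.inr (Sum.inr e))) (gaussianPi _) :=
    (measurePreserving_comp_gaussianPi (Sum.inr_injective.comp
      Sum.inr_injective)).integrable_comp_of_integrable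
      (integrable_gaussianPi (continuous_freeEnergy β b) (expGrowth_freeEnergy β b))
  rw [integral_add ia ib,
    integral_comp_gaussianPi (e := fun e => Sum.inr (Sum.inl e))
      (Sum.inr_injective.comp Sum.inl_injective)
      (continuous_freeEnergy β a),
    integral_comp_gaussianPi (e := fun e => Sum.inr (Sum.inr e))
      (Sum.inr_injective.comp Sum.inr_injective)
      (continuous_freeEnergy β b),
    integral_comp_gaussianPi Sum.inl_injective (continuous_freeEnergy β (a + b))] at h3
  simpa [meanFreeEnergy] using h3

/-- Superadditivity of the mean free energy (Guerra and Toninelli). -/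
lemma meanFreeEnergy_add_le (β : ℝ) (a b : ℕ) :
    meanFreeEnergy β a + meanFreeEnergy β b ≤ meanFreeEnergy β (a + b) := by
  rcases Nat.eq_zero_or_pos a with rfl | ha
  · rw [meanFreeEnergy_zero, zero_add, zero_add]
  rcases Nat.eq_zero_or_pos b with rfl | hb
  · rw [meanFreeEnergy_zero, add_zero, add_zero]
  exact meanFreeEnergy_add_le_of_pos β ha hb

end Superadditive

/-! ### Elementary properties of the log-mean -/

section LogMean

variable {L : NNReal} {f h : ℝ → ℝ}

lemma abs_le_of_lipschitz (hf : LipschitzWith L f) (x : ℝ) : |f x| ≤ |f 0| + L * ‖x‖ := by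
  have h1 := hf.dist_le_mul x 0
  rw [Real.dist_eq, dist_zero_right] at h1
  linarith [abs_sub_abs_le_abs_sub (f x) (f 0)]

lemma integrable_of_lipschitz (hf : LipschitzWith L f) : Integrable f (gaussianReal 0 1) :=
  integrable_of_expGrowth hf.continuous (ExpGrowth.of_affine (abs_le_of_lipschitz hf))

lemma integrable_exp_of_lipschitz (hf : LipschitzWith L f) (m : ℝ) :
    Integrable (fun x => Real.exp (m * f x)) (gaussianReal 0 1) := by
  refine integrable_of_expGrowth (by have := hf.continuous; fun_prop)
    (expGrowth_exp (A := |m| * |f 0|) (c := |m| * L) (by positivity) fun x => ?_)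
  calc m * f x ≤ |m * f x| := le_abs_self _
    _ = |m| * |f x| := abs_mul _ _
    _ ≤ |m| * (|f 0| + L * ‖x‖) :=
      mul_le_mul_of_nonneg_left (abs_le_of_lipschitz hf x) (abs_nonneg m)
    _ = _ := by ring

lemma logMean_const (m a : ℝ) : logMean m (fun _ => a) = a := by
  rcases eq_or_ne m 0 with rfl | hm
  · simp [logMean]
  · simp [logMean, hm]

lemma logMean_add_const (hf : LipschitzWith L f) (m a : ℝ) :
    logMean m (fun x => f x + a) = logMean m f + a := by
  rcases eq_or_ne m 0 with rfl | hm
  · simp [logMean, integral_add (integrable_of_lipschitz hf) (integrable_const a)]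
  · have h1 := integral_exp_pos (integrable_exp_of_lipschitz hf m)
    simp only [logMean, hm, if_false, mul_add, Real.exp_add, integral_mul_const]
    rw [Real.log_mul h1.ne' (Real.exp_pos _).ne', Real.log_exp]
    field_simp

lemma logMean_mono (hf : LipschitzWith L f) (hh : LipschitzWith L h) (hle : ∀ x, f x ≤ h x)
    {m : ℝ} (hm : 0 ≤ m) : logMean m f ≤ logMean m h := by
  rcases hm.eq_or_lt with rfl | hm
  · simp only [logMean, if_true]
    exact integral_mono (integrable_of_lipschitz hf) (integrable_of_lipschitz hh) hle
  · simp only [logMean, hm.ne', if_false]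
    refine mul_le_mul_of_nonneg_left (Real.log_le_log
      (integral_exp_pos (integrable_exp_of_lipschitz hf m)) ?_) (by positivity)
    exact integral_mono (integrable_exp_of_lipschitz hf m) (integrable_exp_of_lipschitz hh m)
      fun x => Real.exp_le_exp.2 (mul_le_mul_of_nonneg_left (hle x) hm.le)

lemma lipschitzWith_affine (hf : LipschitzWith L f) (y s : ℝ) :
    LipschitzWith (L * ‖s‖₊) fun x => f (y + s * x) := by
  refine LipschitzWith.of_dist_le_mul fun a b => (hf.dist_le_mul _ _).trans (le_of_eq ?_)
  rw [Real.dist_eq, Real.dist_eq, add_sub_add_left_eq_sub, ← mul_sub, abs_mul]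
  push_cast
  rw [Real.norm_eq_abs, mul_assoc]

/-- A monotone operator that commutes with adding constants does not increase Lipschitz constants.
-/
lemma lipschitzWith_logMean (hf : LipschitzWith L f) (s : ℝ) {m : ℝ} (hm : 0 ≤ m) :
    LipschitzWith L fun y => logMean m fun x => f (y + s * x) := by
  refine LipschitzWith.of_le_add_mul L fun y z => ?_
  rw [← logMean_add_const (lipschitzWith_affine hf z s)]
  refine logMean_mono (L := L * ‖s‖₊) (lipschitzWith_affine hf y s)
    (by simpa using (lipschitzWith_affine hf z s).add (LipschitzWith.const (L * dist y z)))
    (fun x => ?_) hm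
  have := hf.dist_le_mul (y + s * x) (z + s * x)
  rw [dist_add_right, Real.dist_eq] at this
  linarith [le_abs_self (f (y + s * x) - f (z + s * x))]

lemma gaussPowerMean_exp (hf : LipschitzWith L f) (m : ℝ) :
    gaussPowerMean m (fun x => Real.exp (f x)) = Real.exp (logMean m f) := by
  rcases eq_or_ne m 0 with rfl | hm
  · simp [gaussPowerMean, logMean]
  · simp only [gaussPowerMean, logMean, hm, if_false, ← Real.exp_mul, mul_comm (f _) m]
    rw [Real.rpow_def_of_pos (integral_exp_pos (integrable_exp_of_lipschitz hf m)), mul_comm]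

end LogMean

/-! ### Reduction of the RSB recursion to one real variable -/

section Recursion

variable {k : ℕ}

/-- `log (2 cosh (β y))`. -/
noncomputable def logTwoCosh (β y : ℝ) : ℝ := Real.log (2 * Real.cosh (β * y))

lemma lipschitzWith_logTwoCosh (β : ℝ) : LipschitzWith ‖β‖₊ (logTwoCosh β) := by
  refine LipschitzWith.of_le_add_mul _ fun x y => ?_
  have hp : ∀ z : ℝ, 0 < 2 * Real.cosh z := fun z => mul_pos two_pos (Real.cosh_pos z)
  unfold logTwoCosh
  rw [← Real.log_exp ((‖β‖₊ : ℝ) * dist x y), ← Real.log_mul (hp _).ne' (Real.exp_pos _).ne']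
  refine Real.log_le_log (hp _) ?_
  have hd : (‖β‖₊ : ℝ) * dist x y = |β * x - β * y| := by
    rw [← mul_sub, abs_mul, Real.dist_eq]; rfl
  rw [hd, Real.cosh_eq, Real.cosh_eq]
  have h1 : Real.exp (β * x) ≤ Real.exp (β * y) * Real.exp |β * x - β * y| := by
    rw [← Real.exp_add]
    exact Real.exp_le_exp.2 (by linarith [le_abs_self (β * x - β * y)])
  have h2 : Real.exp (-(β * x)) ≤ Real.exp (-(β * y)) * Real.exp |β * x - β * y| := by
    rw [← Real.exp_add]
    exact Real.exp_le_exp.2 (by linarith [neg_le_abs (β * x - β * y)])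
  linarith

/-- The one-dimensional recursion: `log Z_l` as a function of the field accumulated up to level
`l`. -/
noncomputable def rsbLog (β : ℝ) (p : RSBParams k) (l : Fin (k + 1)) : ℝ → ℝ :=
  Fin.reverseInduction (motive := fun _ => ℝ → ℝ) (logTwoCosh β)
    (fun i X y => logMean (p.m i) fun x => X (y + √(p.q i.succ - p.q i.castSucc) * x)) l

lemma rsbLog_last (β : ℝ) (p : RSBParams k) : rsbLog β p (Fin.last k) = logTwoCosh β := by
  simp [rsbLog]

lemma rsbLog_castSucc (β : ℝ) (p : RSBParams k) (i : Fin k) :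
    rsbLog β p i.castSucc = fun y =>
      logMean (p.m i) fun x => rsbLog β p i.succ (y + √(p.q i.succ - p.q i.castSucc) * x) := by
  simp [rsbLog]

lemma lipschitzWith_rsbLog (β : ℝ) (p : RSBParams k) (l : Fin (k + 1)) :
    LipschitzWith ‖β‖₊ (rsbLog β p l) := by
  induction l using Fin.reverseInduction with
  | last => rw [rsbLog_last]; exact lipschitzWith_logTwoCosh β
  | cast i ih => rw [rsbLog_castSucc]; exact lipschitzWith_logMean ih _ (p.m_mem i).1

/-- The field accumulated up to level `l`. -/
noncomputable def fieldUpTo (p : RSBParams k) (l : Fin (k + 1)) (g : Fin (k + 1) → ℝ) : ℝ :=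
  √(p.q 0) * g 0 + ∑ i : Fin k,
    if i.succ ≤ l then √(p.q i.succ - p.q i.castSucc) * g i.succ else 0

lemma fieldUpTo_update (p : RSBParams k) (i : Fin k) (g : Fin (k + 1) → ℝ) (x : ℝ) :
    fieldUpTo p i.succ (Function.update g i.succ x)
      = fieldUpTo p i.castSucc g + √(p.q i.succ - p.q i.castSucc) * x := by
  unfold fieldUpTo
  rw [add_assoc, Function.update_of_ne (Fin.succ_ne_zero i).symm]
  congr 1
  have e : √(p.q i.succ - p.q i.castSucc) * x
      = ∑ j : Fin k, if j = i then √(p.q i.succ - p.q i.castSucc) * x else 0 := by simp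
  rw [e, ← Finset.sum_add_distrib]
  refine Finset.sum_congr rfl fun j _ => ?_
  rcases lt_trichotomy j i with h | rfl | h
  · have h1 : j.succ ≤ i.castSucc := Fin.succ_le_castSucc_iff.2 h
    have h2 : j.succ ≤ i.succ := Fin.succ_le_succ_iff.2 h.le
    simp [h1, h2, h.ne]
  · simp
  · have h1 : ¬ j.succ ≤ i.castSucc := fun h' => (Fin.succ_le_castSucc_iff.1 h').not_gt h
    have h2 : ¬ j.succ ≤ i.succ := fun h' => (Fin.succ_le_succ_iff.1 h').not_gt h
    simp [h1, h2, h.ne']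

/-- Each `Z_l` sees the Gaussians only through the field accumulated so far, and integrating out the
next coordinate adds one increment to that field. -/
lemma rsbZ_eq_exp (β : ℝ) (p : RSBParams k) (l : Fin (k + 1)) (g : Fin (k + 1) → ℝ) :
    rsbZ β p l g = Real.exp (rsbLog β p l (fieldUpTo p l g)) := by
  induction l using Fin.reverseInduction generalizing g with
  | last =>
    have h : fieldUpTo p (Fin.last k) g = field p g := by simp [fieldUpTo, field, Fin.le_last]
    rw [rsbLog_last, h, logTwoCosh, Real.exp_log (mul_pos two_pos (Real.cosh_pos _))]
    simp [rsbZ]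
  | cast i ih =>
    have h : rsbZ β p i.castSucc g
        = gaussPowerMean (p.m i) fun x => rsbZ β p i.succ (Function.update g i.succ x) := by
      simp [rsbZ]
    rw [h, rsbLog_castSucc]
    simp only [ih, fieldUpTo_update]
    exact gaussPowerMean_exp (lipschitzWith_affine (lipschitzWith_rsbLog β p i.succ) _ _) _

lemma integral_eval_gaussianPi {ι : Type*} [Fintype ι] (i : ι) {f : ℝ → ℝ} (hf : Continuous f) :
    ∫ g, f (g i) ∂(gaussianPi ι) = ∫ x, f x ∂(gaussianReal 0 1) := by
  have h := measurePreserving_eval (fun _ : ι => gaussianReal 0 1) i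
  rw [← h.map_eq, integral_map h.measurable.aemeasurable hf.aestronglyMeasurable]

lemma rsbF_eq (β : ℝ) (p : RSBParams k) :
    rsbF β p = ∫ x, rsbLog β p 0 (√(p.q 0) * x) ∂(gaussianReal 0 1) := by
  have hc := (lipschitzWith_rsbLog β p 0).continuous
  rw [← integral_eval_gaussianPi (0 : Fin (k + 1))
    (f := fun x => rsbLog β p 0 (√(p.q 0) * x)) (by fun_prop), rsbF]
  simp [rsbZ_eq_exp, fieldUpTo]

end Recursion

/-! ### Guerra's interpolation and the finite-size bound -/

section Guerra

variable {n k : ℕ}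

/-- The SK model of size `n` together with `n` independent fields. -/
noncomputable def guerraVec (β : ℝ) (n : ℕ) (σ : Fin n → ℤˣ) : (Fin n × Fin n) ⊕ Fin n → ℝ :=
  Sum.elim (skVec β n σ) fun i => β * spin σ i

/-- The interpolating functions of Guerra's scheme, one for each level. -/
noncomputable def guerraU (β : ℝ) (n : ℕ) (p : RSBParams k) (l : Fin (k + 1)) :
    ℝ × ((Fin n × Fin n) ⊕ Fin n → ℝ) → ℝ :=
  Fin.reverseInduction (motive := fun _ => ℝ × ((Fin n × Fin n) ⊕ Fin n → ℝ) → ℝ)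
    (logSumExp (guerraVec β n))
    (fun i U => smoothLogs (p.m i) 0 (fun _ => √(p.q i.succ - p.q i.castSucc))
      ((Finset.univ : Finset (Fin n)).toList.map Sum.inr) U) l

lemma guerraU_last (β : ℝ) (p : RSBParams k) :
    guerraU β n p (Fin.last k) = logSumExp (guerraVec β n) := by
  simp [guerraU]

lemma guerraU_castSucc (β : ℝ) (p : RSBParams k) (i : Fin k) :
    guerraU β n p i.castSucc
      = smoothLogs (p.m i) 0 (fun _ => √(p.q i.succ - p.q i.castSucc))
        ((Finset.univ : Finset (Fin n)).toList.map Sum.inr) (guerraU β n p i.succ) := by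
  simp [guerraU]

lemma RSBParams.m_le_snoc (p : RSBParams k) (i : Fin k) :
    p.m i ≤ Fin.snoc (α := fun _ => ℝ) p.m 1 i.succ := by
  rcases Fin.eq_castSucc_or_eq_last i.succ with ⟨j, hj⟩ | h
  · rw [hj, Fin.snoc_castSucc]
    exact p.m_mono (Fin.castSucc_le_castSucc_iff.1 (hj ▸ (Fin.castSucc_lt_succ (i := i)).le))
  · rw [h, Fin.snoc_last]
    exact (p.m_mem i).2

lemma RSBParams.snoc_nonneg (p : RSBParams k) (l : Fin (k + 1)) :
    0 ≤ Fin.snoc (α := fun _ => ℝ) p.m 1 l := by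
  rcases Fin.eq_castSucc_or_eq_last l with ⟨j, rfl⟩ | rfl
  · rw [Fin.snoc_castSucc]; exact (p.m_mem j).1
  · rw [Fin.snoc_last]; exact zero_le_one

/-- Completing the square: the covariance form on a pair with overlap `R` is `β² / (2n) (R - n q)² -
β² n q² / 2`. The discarded square is Guerra's nonnegative remainder. -/
lemma neg_le_quadratic_guerraVec (β : ℝ) (hn : 0 < n) (q : ℝ)
    {x : (Fin n × Fin n) ⊕ Fin n → ℝ} (hx : x ∈ convexHull ℝ (Set.range (guerraVec β n))) :
    -(β ^ 2 * n / 2 * q ^ 2)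
      ≤ ∑ j, (Sum.elim (fun _ => 1) fun _ => -q : (Fin n × Fin n) ⊕ Fin n → ℝ) j * x j ^ 2 := by
  refine le_quadratic_of_mem_convexHull (fun σ τ => ?_) hx
  have e : ∑ i, -q * (β * spin σ i * (β * spin τ i)) = -q * β ^ 2 * overlap σ τ := by
    rw [overlap, Finset.mul_sum]
    exact Finset.sum_congr rfl fun i _ => by ring
  simp only [Fintype.sum_sum_type, Sum.elim_inl, Sum.elim_inr, guerraVec, one_mul,
    sum_skVec_mul, e]
  have hn' : (0 : ℝ) < n := by exact_mod_cast hn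
  have : 0 ≤ β ^ 2 / (2 * n) * (overlap σ τ - n * q) ^ 2 := by positivity
  have e2 : β ^ 2 / (2 * n) * (overlap σ τ - n * q) ^ 2 = β ^ 2 / (2 * n) * overlap σ τ ^ 2
      - q * β ^ 2 * overlap σ τ + β ^ 2 * n / 2 * q ^ 2 := by
    field_simp; ring
  linarith

/-- Going down from level `i + 1` to `i`, lowering `m` from `m_{i+1}` to `m_i` (with `m_k = 1`)
costs the increment times `β² n q_{i+1}² / 2`. Smoothing the fields with variance `q_{i+1} - q_i`
then moves their weight from `-q_{i+1}` to `-q_i`. -/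
lemma flow_guerraU (β : ℝ) (hn : 0 < n) (p : RSBParams k) (l : Fin (k + 1)) :
    Flow (convexHull ℝ (Set.range (guerraVec β n))) (Fin.snoc (α := fun _ => ℝ) p.m 1 l)
      (Sum.elim (fun _ => 1) fun _ => -p.q l)
      (β ^ 2 * n / 2 * (1 - 2 * p.q (Fin.last k)) + ∑ j : Fin (k + 1), if l < j then
        (Fin.snoc (α := fun _ => ℝ) p.m 1 j - Fin.cons (α := fun _ => ℝ) 0 p.m j)
          * (β ^ 2 * n / 2 * p.q j ^ 2) else 0)
      (guerraU β n p l) := by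
  induction l using Fin.reverseInduction with
  | last =>
    have h0 : ∀ j : Fin (k + 1), ¬ Fin.last k < j := fun j => (Fin.le_last j).not_gt
    simp only [h0, if_false, Finset.sum_const_zero, add_zero, Fin.snoc_last]
    rw [guerraU_last]
    -- The diagonal is the same for every configuration: `β² n / 2` from the couplings and `-q_k β²
    -- n` from the fields.
    refine flow_logSumExp _ fun σ => le_of_eq ?_
    simp only [Fintype.sum_sum_type, Sum.elim_inl, Sum.elim_inr, guerraVec, one_mul, sum_skVec_sq,
      mul_pow, sq (spin σ _), spin_mul_self]
    simp
    ring
  | cast i ih =>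
    have h1 := ih.weaken (p.m_le_snoc i) fun x hx => neg_le_quadratic_guerraVec β hn (p.q i.succ) hx
    have h2 := h1.smoothLogs (isCompact_hull _) (convex_convexHull ℝ _) (b := 0)
      (c := fun _ => √(p.q i.succ - p.q i.castSucc)) (fun _ => by simp)
      ((Finset.univ : Finset (Fin n)).toList.map Sum.inr)
    rw [guerraU_castSucc, Fin.snoc_castSucc]
    convert h2 using 1
    · have hq : 0 ≤ p.q i.succ - p.q i.castSucc :=
        sub_nonneg.2 (p.q_mono (Fin.castSucc_lt_succ (i := i)).le)
      rw [List.map_map]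
      simp only [Function.comp_def]
      rw [Finset.sum_map_toList]
      ext j
      rcases j with j | j
      · simp
      · simp [Finset.sum_apply, Pi.single_apply, Real.sq_sqrt hq]
        ring
    · rw [add_assoc]
      congr 1
      have e : (Fin.snoc (α := fun _ => ℝ) p.m 1 i.succ - p.m i) * (β ^ 2 * n / 2 * p.q i.succ ^ 2)
          = ∑ j : Fin (k + 1), if j = i.succ then
            (Fin.snoc (α := fun _ => ℝ) p.m 1 j - Fin.cons (α := fun _ => ℝ) 0 p.m j)
              * (β ^ 2 * n / 2 * p.q j ^ 2) else 0 := by simp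
      rw [e, ← Finset.sum_add_distrib]
      refine Finset.sum_congr rfl fun j _ => ?_
      rcases lt_trichotomy j i.succ with h | rfl | h
      · have h' : ¬ i.castSucc < j := fun h'' => (Fin.castSucc_lt_iff_succ_le.1 h'').not_gt h
        simp [h', h.ne, h.not_gt]
      · simp
      · have h' : i.castSucc < j := Fin.castSucc_lt_succ.trans h
        simp [h', h.ne', h]

lemma smoothLogs_of_amp_eq_zero {ι : Type*} [DecidableEq ι] {m θ : ℝ} {b c : ι → ℝ}
    (h : ∀ i, amp (b i) (c i) θ = 0) (l : List ι) (U : ℝ × (ι → ℝ) → ℝ) (x : ι → ℝ) :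
    smoothLogs m b c l U (θ, x) = U (θ, x) := by
  induction l with
  | nil => rfl
  | cons i l ih =>
    simp only [smoothLogs, List.foldr_cons] at ih ⊢
    simp [smoothLog, shift, h, ih, logMean_const]

/-- The smoothed fields have amplitude proportional to `cos θ`, so at `π/2` every smoothing is the
log-mean of a constant. -/
lemma guerraU_pi_div_two (β : ℝ) (p : RSBParams k) (l : Fin (k + 1))
    (x : (Fin n × Fin n) ⊕ Fin n → ℝ) :
    guerraU β n p l (Real.pi / 2, x) = logSumExp (guerraVec β n) (Real.pi / 2, x) := by
  induction l using Fin.reverseInduction with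
  | last => rw [guerraU_last]
  | cast i ih =>
    rw [guerraU_castSucc, smoothLogs_of_amp_eq_zero (fun _ => by simp [amp]), ih]

/-- Decoupling of sites at `θ = 0`: when one site is averaged, the terms of the other sites are
constants and pass through `logMean`. -/
lemma smoothLogs_sum {f : ℝ → ℝ} {L : NNReal} (hf : LipschitzWith L f) {ι : Type*}
    [DecidableEq ι] {U : ℝ × (ι ⊕ Fin n → ℝ) → ℝ}
    (hU : ∀ y, U (0, Sum.elim (fun _ => 0) y) = ∑ j, f (y j)) (m s : ℝ) {l : List (Fin n)}
    (hl : l.Nodup) (y : Fin n → ℝ) :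
    smoothLogs m 0 (fun _ => s) (l.map Sum.inr) U (0, Sum.elim (fun _ => 0) y)
      = ∑ j, if j ∈ l then logMean m (fun x => f (y j + s * x)) else f (y j) := by
  induction l generalizing y with
  | nil => simp [smoothLogs, hU]
  | cons i l ih =>
    have hi := (List.nodup_cons.1 hl).1
    simp only [smoothLogs, List.map_cons, List.foldr_cons] at ih ⊢
    have e : ∀ g, shift (Sum.inr i : ι ⊕ Fin n) ((0 : ι ⊕ Fin n → ℝ) (Sum.inr i)) s
        (0, Sum.elim (fun _ => 0) y) g
        = (0, Sum.elim (fun _ => 0) (y + Pi.single i (s * g))) := fun g => by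
      ext j
      · rfl
      · rcases j with j | j
        · simp [shift]
        · simp [shift, amp, Pi.single_apply]
    simp only [smoothLog, e, ih (List.nodup_cons.1 hl).2]
    rw [← Finset.add_sum_erase _ _ (Finset.mem_univ i)]
    rw [if_pos List.mem_cons_self,
      ← logMean_add_const (lipschitzWith_affine hf (y i) s)]
    congr 1
    ext g
    rw [← Finset.add_sum_erase _ _ (Finset.mem_univ i), if_neg hi]
    congr 1
    · simp
    · refine Finset.sum_congr rfl fun j hj => ?_
      have hj' := Finset.ne_of_mem_erase hj
      simp [hj']

lemma sum_exp_spin (β : ℝ) (y : Fin n → ℝ) :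
    Real.log (∑ σ : Fin n → ℤˣ, Real.exp (∑ i, β * spin σ i * y i))
      = ∑ i, logTwoCosh β (y i) := by
  have h := Finset.prod_univ_sum (fun _ : Fin n => (Finset.univ : Finset ℤˣ))
    (fun i s => Real.exp (β * ((s : ℤ) : ℝ) * y i))
  simp only [Fintype.piFinset_univ, ← Real.exp_sum] at h
  simp only [spin]
  rw [← h, Real.log_prod fun i _ => (Finset.sum_pos (fun _ _ => Real.exp_pos _)
    Finset.univ_nonempty).ne']
  refine Finset.sum_congr rfl fun i _ => ?_
  rw [logTwoCosh, Real.cosh_eq]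
  congr 1
  simp [UnitsInt.univ]
  ring

lemma guerraU_zero (β : ℝ) (p : RSBParams k) (l : Fin (k + 1)) (y : Fin n → ℝ) :
    guerraU β n p l (0, Sum.elim (fun _ => 0) y) = ∑ i, rsbLog β p l (y i) := by
  induction l using Fin.reverseInduction generalizing y with
  | last =>
    rw [guerraU_last, rsbLog_last, ← sum_exp_spin]
    simp [logSumExp, guerraVec]
  | cast i ih =>
    rw [guerraU_castSucc, smoothLogs_sum (lipschitzWith_rsbLog β p i.succ) ih _ _
      (Finset.nodup_toList _), rsbLog_castSucc]
    simp

/-- Guerra's replica symmetry breaking bound for finite systems. -/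
theorem meanFreeEnergy_le (β : ℝ) (n : ℕ) (p : RSBParams k) :
    meanFreeEnergy β n ≤ n * rsbFunctional β p := by
  rcases Nat.eq_zero_or_pos n with rfl | hn
  · simp [meanFreeEnergy_zero]
  -- The last drop, from `m_0` to `m_{-1} = 0`, supplies the `l = 0` term missing from the strict
  -- sum `0 < j`.
  have h1 := (flow_guerraU β hn p 0).weaken (p.snoc_nonneg 0)
    fun x hx => neg_le_quadratic_guerraVec β hn (p.q 0) hx
  have h2 := h1.integral_le (isCompact_hull _) (convex_convexHull ℝ _)
    (b := Sum.elim (fun _ => 1) fun _ => 0) (c := Sum.elim (fun _ => 0) fun _ => √(p.q 0))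
    (by rintro (i | i) <;> simp)
    (by rintro (i | i) <;> simp [Real.sq_sqrt (p.q_mem 0).1])
  have eL : ∀ g : (Fin n × Fin n) ⊕ Fin n → ℝ, guerraU β n p 0
      (Real.pi / 2, fun i => (Sum.elim (fun _ => 1) fun _ => 0 : _ → ℝ) i * g i)
      = freeEnergy β n fun e => g (Sum.inl e) := fun g => by
    rw [guerraU_pi_div_two]
    simp [logSumExp, freeEnergy, guerraVec]
  have eR : ∀ g : (Fin n × Fin n) ⊕ Fin n → ℝ, guerraU β n p 0
      (0, fun i => (Sum.elim (fun _ => 0) fun _ => √(p.q 0) : _ → ℝ) i * g i)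
      = ∑ i, rsbLog β p 0 (√(p.q 0) * g (Sum.inr i)) := fun g => by
    rw [← guerraU_zero β p 0 fun i => √(p.q 0) * g (Sum.inr i)]
    congr 2
    ext i
    rcases i with i | i <;> simp
  have hL : LipschitzWith (‖β‖₊ * ‖√(p.q 0)‖₊) fun x => rsbLog β p 0 (√(p.q 0) * x) := by
    simpa using lipschitzWith_affine (lipschitzWith_rsbLog β p 0) 0 (√(p.q 0))
  have hI : ∀ i : Fin n, Integrable (fun g => rsbLog β p 0 (√(p.q 0) * g (Sum.inr i)))
      (gaussianPi ((Fin n × Fin n) ⊕ Fin n)) := fun i =>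
    (measurePreserving_eval (fun _ : (Fin n × Fin n) ⊕ Fin n => gaussianReal 0 1)
      (Sum.inr i)).integrable_comp_of_integrable (integrable_of_lipschitz hL)
  simp only [eL, eR] at h2
  rw [integral_comp_gaussianPi Sum.inl_injective (continuous_freeEnergy β n),
    integral_finsetSum _ fun i _ => hI i] at h2
  have hE := fun i : Fin n =>
    integral_eval_gaussianPi (Sum.inr i : (Fin n × Fin n) ⊕ Fin n) hL.continuous
  simp only [hE, ← rsbF_eq] at h2
  refine h2.trans (le_of_eq ?_)
  have e : ∀ f : Fin (k + 1) → ℝ, (∑ j, if 0 < j then f j else 0) + f 0 = ∑ j, f j := fun f => by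
    rw [Fin.sum_univ_succ, Fin.sum_univ_succ (f := f)]
    simp [add_comm]
  have e1 := e fun j => (Fin.snoc (α := fun _ => ℝ) p.m 1 j - Fin.cons (α := fun _ => ℝ) 0 p.m j)
    * (β ^ 2 * n / 2 * p.q j ^ 2)
  rw [Fin.cons_zero] at e1
  rw [add_assoc, e1, rsbFunctional]
  have e2 : ∑ j, (Fin.snoc (α := fun _ => ℝ) p.m 1 j - Fin.cons (α := fun _ => ℝ) 0 p.m j)
      * (β ^ 2 * n / 2 * p.q j ^ 2) = β ^ 2 * n / 2 * ∑ j,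
      (Fin.snoc (α := fun _ => ℝ) p.m 1 j - Fin.cons (α := fun _ => ℝ) 0 p.m j) * p.q j ^ 2 := by
    rw [Finset.mul_sum]
    exact Finset.sum_congr rfl fun j _ => by ring
  rw [e2]
  simp
  ring

end Guerra

/-! ### Gaussian concentration, one coordinate at a time -/

section Concentration

lemma integral_exp_gaussian (t : ℝ) :
    ∫ x, Real.exp (t * x) ∂(gaussianReal 0 1) = Real.exp (t ^ 2 / 2) := by
  have := mgf_gaussianReal (p := gaussianReal 0 1) (X := id) (Measure.map_id) t
  simpa [mgf] using this

/-- A Lipschitz function of a standard Gaussian variable is sub-Gaussian. -/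
lemma integral_exp_le_of_lipschitz {L : NNReal} {f : ℝ → ℝ} (hf : LipschitzWith L f) (t : ℝ) :
    ∫ x, Real.exp (t * f x) ∂(gaussianReal 0 1)
      ≤ Real.exp (t * (∫ x, f x ∂(gaussianReal 0 1)) + t ^ 2 * (L : ℝ) ^ 2) := by
  set γ := gaussianReal 0 1
  have hi := integrable_of_lipschitz hf
  have hp := integrable_exp_of_lipschitz hf t
  have hm := integrable_exp_of_lipschitz hf (-t)
  have jensen : Real.exp (-t * ∫ x, f x ∂γ) ≤ ∫ x, Real.exp (-t * f x) ∂γ := by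
    have := convexOn_exp.map_integral_le (μ := γ) (f := fun x => -t * f x)
      Real.continuous_exp.continuousOn isClosed_univ (Eventually.of_forall fun _ => Set.mem_univ _)
      (hi.const_mul _) hm
    rwa [integral_const_mul] at this
  have i1 : Integrable (fun q : ℝ × ℝ => Real.exp (t * f q.1) * Real.exp (-t * f q.2))
      (γ.prod γ) := hp.mul_prod hm
  have i2 : Integrable (fun q : ℝ × ℝ => Real.exp (-t * f q.1) * Real.exp (t * f q.2))
      (γ.prod γ) := hm.mul_prod hp
  have g1 : Integrable (fun q : ℝ × ℝ => Real.exp (t * L * q.1) * Real.exp (-(t * L) * q.2))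
      (γ.prod γ) := (integrable_exp_mul_gaussianReal _).mul_prod (integrable_exp_mul_gaussianReal _)
  have g2 : Integrable (fun q : ℝ × ℝ => Real.exp (-(t * L) * q.1) * Real.exp (t * L * q.2))
      (γ.prod γ) := (integrable_exp_mul_gaussianReal _).mul_prod (integrable_exp_mul_gaussianReal _)
  -- Symmetrisation over an independent copy turns the integrand into `2 cosh (t (f x - f y))`. As
  -- `cosh` increases with the absolute value, the Lipschitz bound replaces `f` by `L` times the
  -- identity.
  have key : ∫ q : ℝ × ℝ, (Real.exp (t * f q.1) * Real.exp (-t * f q.2)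
        + Real.exp (-t * f q.1) * Real.exp (t * f q.2)) ∂(γ.prod γ)
      ≤ ∫ q : ℝ × ℝ, (Real.exp (t * L * q.1) * Real.exp (-(t * L) * q.2)
        + Real.exp (-(t * L) * q.1) * Real.exp (t * L * q.2)) ∂(γ.prod γ) := by
    refine integral_mono (i1.add i2) (g1.add g2) fun q => ?_
    have hc : Real.cosh (t * (f q.1 - f q.2)) ≤ Real.cosh (t * L * (q.1 - q.2)) := by
      refine Real.cosh_le_cosh.2 ?_
      rw [mul_assoc, abs_mul, abs_mul t, abs_mul, NNReal.abs_eq]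
      exact mul_le_mul_of_nonneg_left (hf.dist_le_mul q.1 q.2) (abs_nonneg t)
    rw [Real.cosh_eq, Real.cosh_eq] at hc
    simp only [← Real.exp_add]
    calc _ = Real.exp (t * (f q.1 - f q.2)) + Real.exp (-(t * (f q.1 - f q.2))) := by
          congr 2 <;> ring
      _ ≤ Real.exp (t * L * (q.1 - q.2)) + Real.exp (-(t * L * (q.1 - q.2))) := by linarith
      _ = _ := by congr 2 <;> ring
  rw [integral_add i1 i2, integral_add g1 g2] at key
  simp only [integral_prod_mul (fun x => Real.exp (t * f x)) fun x => Real.exp (-t * f x),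
    integral_prod_mul (fun x => Real.exp (-t * f x)) fun x => Real.exp (t * f x),
    integral_prod_mul (fun x => Real.exp (t * L * x)) fun x => Real.exp (-(t * L) * x),
    integral_prod_mul (fun x => Real.exp (-(t * L) * x)) fun x => Real.exp (t * L * x),
    γ, integral_exp_gaussian] at key
  have hA : 0 < ∫ x, Real.exp (t * f x) ∂γ := integral_exp_pos hp
  -- Jensen removes the copy. Its variance stays behind, so the exponent is `t² L²` rather than the
  -- sharp `t² L² / 2`; any constant suffices for Borel–Cantelli.
  have h1 : (∫ x, Real.exp (t * f x) ∂γ) * Real.exp (-t * ∫ x, f x ∂γ)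
      ≤ Real.exp (t ^ 2 * (L : ℝ) ^ 2) := by
    have e : Real.exp ((t * L) ^ 2 / 2) * Real.exp ((-(t * L)) ^ 2 / 2)
        = Real.exp (t ^ 2 * (L : ℝ) ^ 2) := by
      rw [← Real.exp_add]; congr 1; ring
    have := mul_le_mul_of_nonneg_left jensen hA.le
    rw [mul_comm (Real.exp ((-(t * L)) ^ 2 / 2)), e] at key
    linarith [mul_comm (∫ x, Real.exp (t * f x) ∂γ) (∫ x, Real.exp (-t * f x) ∂γ)]
  calc ∫ x, Real.exp (t * f x) ∂γ
      = (∫ x, Real.exp (t * f x) ∂γ) * Real.exp (-t * ∫ x, f x ∂γ)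
          * Real.exp (t * ∫ x, f x ∂γ) := by
        rw [mul_assoc, ← Real.exp_add, neg_mul, neg_add_cancel, Real.exp_zero, mul_one]
    _ ≤ Real.exp (t ^ 2 * (L : ℝ) ^ 2) * Real.exp (t * ∫ x, f x ∂γ) :=
        mul_le_mul_of_nonneg_right h1 (Real.exp_pos _).le
    _ = _ := by rw [← Real.exp_add, add_comm]

variable {ι : Type*} [Fintype ι] [DecidableEq ι]

/-- Lipschitz continuity in each coordinate separately. -/
def CoordLipschitz (c : ι → NNReal) (f : (ι → ℝ) → ℝ) : Prop :=
  ∀ (i : ι) (x : ι → ℝ) (s t : ℝ), |f (x + Pi.single i s) - f (x + Pi.single i t)| ≤ c i * |s - t|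

omit [Fintype ι] in
lemma CoordLipschitz.lipschitzWith {c : ι → NNReal} {f : (ι → ℝ) → ℝ} (h : CoordLipschitz c f)
    (i : ι) (x : ι → ℝ) : LipschitzWith (c i) fun s => f (x + Pi.single i s) :=
  LipschitzWith.of_dist_le_mul fun s t => h i x s t

omit [Fintype ι] in
lemma CoordLipschitz.avg {c : ι → NNReal} {f : (ι → ℝ) → ℝ} (h : CoordLipschitz c f) (i : ι) :
    CoordLipschitz c (avg 1 i f) := by
  intro j x s t
  have hi : ∀ y, Integrable (fun g => f (y + (Pi.single i ((1 : ι → ℝ) i * g) : ι → ℝ)))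
      (gaussianReal 0 1) := fun y => by
    simpa using integrable_of_lipschitz (h.lipschitzWith i y)
  simp only [SK.avg]
  rw [← integral_sub (hi _) (hi _)]
  have := norm_integral_le_of_norm_le_const (μ := gaussianReal 0 1)
    (f := fun g => f (x + Pi.single j s + (Pi.single i ((1 : ι → ℝ) i * g) : ι → ℝ))
      - f (x + Pi.single j t + (Pi.single i ((1 : ι → ℝ) i * g) : ι → ℝ))) (C := c j * |s - t|)
    (Eventually.of_forall fun g => by
      rw [add_right_comm x (Pi.single j s : ι → ℝ), add_right_comm x (Pi.single j t : ι → ℝ)]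
      exact h j _ s t)
  simpa using this

omit [Fintype ι] in
lemma CoordLipschitz.foldr_avg {c : ι → NNReal} {f : (ι → ℝ) → ℝ} (h : CoordLipschitz c f)
    (l : List ι) : CoordLipschitz c (l.foldr (SK.avg 1) f) := by
  induction l with
  | nil => exact h
  | cons i l ih => exact ih.avg i

omit [Fintype ι] in
lemma foldr_avg_nonneg {a : ι → ℝ} {f : (ι → ℝ) → ℝ} (hf : ∀ x, 0 ≤ f x) (l : List ι)
    (x : ι → ℝ) : 0 ≤ l.foldr (avg a) f x := by
  induction l generalizing x with
  | nil => exact hf x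
  | cons i l ih => exact integral_nonneg fun g => ih _

lemma CoordLipschitz.abs_le {c : ι → NNReal} {f : (ι → ℝ) → ℝ} (h : CoordLipschitz c f)
    (x : ι → ℝ) : |f x| ≤ |f 0| + (∑ i, (c i : ℝ)) * ‖x‖ := by
  have key : ∀ s : Finset ι, |f (∑ i ∈ s, Pi.single i (x i)) - f 0| ≤ (∑ i ∈ s, (c i : ℝ)) * ‖x‖ := by
    intro s
    induction s using Finset.induction_on with
    | empty => simp
    | insert i s hi ih =>
      rw [Finset.sum_insert hi, Finset.sum_insert hi, add_comm (Pi.single i (x i) : ι → ℝ)]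
      have h1 := h i (∑ i ∈ s, Pi.single i (x i)) (x i) 0
      rw [Pi.single_zero, add_zero, sub_zero] at h1
      have h2 := mul_le_mul_of_nonneg_left (norm_le_pi_norm x i) (c i).coe_nonneg
      rw [Real.norm_eq_abs] at h2
      have := abs_sub_le (f ((∑ i ∈ s, Pi.single i (x i)) + Pi.single i (x i)))
        (f (∑ i ∈ s, Pi.single i (x i))) (f 0)
      linarith
  have := key Finset.univ
  rw [Finset.univ_sum_single] at this
  linarith [abs_sub_abs_le_abs_sub (f x) (f 0)]

lemma CoordLipschitz.growth_exp {c : ι → NNReal} {f : (ι → ℝ) → ℝ} (h : CoordLipschitz c f)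
    (t : ℝ) : ExpGrowth fun x => Real.exp (t * f x) := by
  refine expGrowth_exp (A := |t| * |f 0|) (c := |t| * ∑ i, (c i : ℝ)) (by positivity) fun x => ?_
  calc t * f x ≤ |t * f x| := le_abs_self _
    _ = |t| * |f x| := abs_mul _ _
    _ ≤ |t| * (|f 0| + (∑ i, (c i : ℝ)) * ‖x‖) :=
      mul_le_mul_of_nonneg_left (h.abs_le x) (abs_nonneg t)
    _ = _ := by ring

omit [Fintype ι] in
-- The tensorisation step: `C` holds the variance of the coordinates already averaged, and the
-- one-dimensional bound adds that of coordinate `i`.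
lemma avg_exp_le {φ ψ : (ι → ℝ) → ℝ} {L : NNReal} {i : ι} {x : ι → ℝ} {t C : ℝ}
    (hφ : LipschitzWith L fun s => φ (x + Pi.single i s)) (hψ : ∀ y, 0 ≤ ψ y)
    (hle : ∀ y, ψ y ≤ Real.exp (t * φ y + C)) :
    avg 1 i ψ x ≤ Real.exp (t * avg 1 i φ x + (t ^ 2 * (L : ℝ) ^ 2 + C)) := by
  have h1 := integral_exp_le_of_lipschitz hφ t
  have i1 := (integrable_exp_of_lipschitz hφ t).mul_const (Real.exp C)
  simp only [SK.avg, Pi.one_apply, one_mul]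
  rw [← add_assoc, Real.exp_add _ C]
  refine le_trans ?_ (mul_le_mul_of_nonneg_right h1 (Real.exp_pos C).le)
  rw [← integral_mul_const]
  refine integral_mono_of_nonneg (Eventually.of_forall fun g => hψ _) i1
    (Eventually.of_forall fun g => ?_)
  beta_reduce
  rw [← Real.exp_add]
  exact hle _

/-- Exponential moments of a coordinatewise Lipschitz function of i.i.d. Gaussian variables. -/
lemma integral_exp_le_gaussianPi {c : ι → NNReal} {f : (ι → ℝ) → ℝ}
    (hc : Continuous f) (h : CoordLipschitz c f) (t : ℝ) :
    ∫ g, Real.exp (t * f g) ∂(gaussianPi ι)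
      ≤ Real.exp (t * (∫ g, f g ∂(gaussianPi ι)) + t ^ 2 * ∑ i, (c i : ℝ) ^ 2) := by
  have hE : Continuous fun x => Real.exp (t * f x) := by fun_prop
  have key : ∀ (l : List ι), l.Nodup → ∀ x,
      l.foldr (SK.avg 1) (fun x => Real.exp (t * f x)) x
      ≤ Real.exp (t * l.foldr (SK.avg 1) f x + t ^ 2 * (l.map fun i => (c i : ℝ) ^ 2).sum) := by
    intro l
    induction l with
    | nil => intro _ x; simp
    | cons i l ih =>
      intro hl x
      have := avg_exp_le ((h.foldr_avg l).lipschitzWith i x)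
        (foldr_avg_nonneg (fun x => (Real.exp_pos _).le) l) (ih (List.nodup_cons.1 hl).2)
      simpa only [List.foldr_cons, List.map_cons, List.sum_cons, mul_add] using this
  have h1 := key Finset.univ.toList (Finset.nodup_toList _) 0
  rw [SK.foldr_avg hE (h.growth_exp t) _ (Finset.nodup_toList _),
    SK.foldr_avg hc (ExpGrowth.of_affine h.abs_le) _ (Finset.nodup_toList _),
    Finset.sum_map_toList] at h1
  have e : ∀ g : ι → ℝ, perturb 1 Finset.univ.toList 0 g = g := fun g => by
    ext; simp [perturb]
  simpa only [e] using h1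

end Concentration

/-! ### Almost sure concentration and existence of the limit -/

section Limit

/-- Spins have modulus 1, so moving one entry changes all exponents by at most the same amount, and
log-sum-exp by no more. -/
lemma coordLipschitz_freeEnergy (β : ℝ) (n : ℕ) :
    CoordLipschitz (fun _ => ‖β / √(2 * n)‖₊) (freeEnergy β n) := by
  have one_sided : ∀ (e : Fin n × Fin n) (x : Fin n × Fin n → ℝ) (s t : ℝ),
      freeEnergy β n (x + Pi.single e s)
        ≤ freeEnergy β n (x + Pi.single e t) + |β / √(2 * n)| * |s - t| := by
    intro e x s t
    have hpos := fun s : ℝ =>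
      sum_exp_pos (skVec β n) (0, x + (Pi.single e s : Fin n × Fin n → ℝ))
    unfold freeEnergy logSumExp
    rw [← Real.log_exp (|β / √(2 * n)| * |s - t|), ← Real.log_mul (hpos t).ne' (Real.exp_pos _).ne',
      Finset.sum_mul]
    refine Real.log_le_log (hpos s) (Finset.sum_le_sum fun σ _ => ?_)
    rw [← Real.exp_add]
    refine Real.exp_le_exp.2 ?_
    have h : skVec β n σ e * (s - t) ≤ |β / √(2 * n)| * |s - t| := by
      refine (le_abs_self _).trans (le_of_eq ?_)
      rw [abs_mul, skVec, abs_mul, abs_mul, abs_spin, abs_spin, mul_one, mul_one]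
    simp only [Pi.add_apply, mul_add, Finset.sum_add_distrib, Pi.single_apply, mul_ite, mul_zero,
      Finset.sum_ite_eq', Finset.mem_univ, if_true]
    linarith
  intro e x s t
  have h1 := one_sided e x s t
  have h2 := one_sided e x t s
  rw [abs_sub_comm t s] at h2
  rw [abs_le]
  simp only [coe_nnnorm, Real.norm_eq_abs]
  constructor <;> linarith

lemma integral_exp_freeEnergy_le (β : ℝ) (n : ℕ) (t : ℝ) :
    mgf (freeEnergy β n) (gaussianPi (Fin n × Fin n)) t
      ≤ Real.exp (t * meanFreeEnergy β n + t ^ 2 * (β ^ 2 / 2 * n)) := by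
  have h := integral_exp_le_gaussianPi (continuous_freeEnergy β n) (coordLipschitz_freeEnergy β n) t
  have e : ∑ _e : Fin n × Fin n, (‖β / √(2 * n)‖₊ : ℝ) ^ 2 = β ^ 2 / 2 * n := by
    -- The sum of squared constants is the squared length of any coefficient vector; all spins up is
    -- convenient.
    rw [← sum_skVec_sq β (fun _ => (1 : ℤˣ))]
    refine Finset.sum_congr rfl fun e _ => ?_
    rw [coe_nnnorm, Real.norm_eq_abs, sq_abs]
    simp [skVec, spin]
  rwa [e] at h

lemma freeEnergy_deviation {β : ℝ} (hβ : 0 < β) (n : ℕ) {ε : ℝ} (hε : 0 < ε) :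
    (gaussianPi (Fin n × Fin n)).real {g | ε * n ≤ |freeEnergy β n g - meanFreeEnergy β n|}
      ≤ 2 * Real.exp (-(ε ^ 2 / (2 * β ^ 2))) ^ n := by
  set X := freeEnergy β n
  set a := meanFreeEnergy β n
  have hint : ∀ t, Integrable (fun g => Real.exp (t * X g)) (gaussianPi (Fin n × Fin n)) :=
    fun t => integrable_gaussianPi (by have := continuous_freeEnergy β n; fun_prop)
      ((coordLipschitz_freeEnergy β n).growth_exp t)
  -- `t = ε / β²` minimises the Chernoff exponent `-t ε n + t² β² n / 2`, with value `-ε² n / (2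
  -- β²)`.
  have ht : 0 ≤ ε / β ^ 2 := by positivity
  have up := measure_ge_le_exp_mul_mgf (a + ε * n) ht (hint (ε / β ^ 2))
  have lo := measure_le_le_exp_mul_mgf (a - ε * n) (neg_nonpos.2 ht) (hint (-(ε / β ^ 2)))
  have hup := mul_le_mul_of_nonneg_left (integral_exp_freeEnergy_le β n (ε / β ^ 2))
    (Real.exp_pos (-(ε / β ^ 2) * (a + ε * n))).le
  have hlo := mul_le_mul_of_nonneg_left (integral_exp_freeEnergy_le β n (-(ε / β ^ 2)))
    (Real.exp_pos (-(-(ε / β ^ 2)) * (a - ε * n))).le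
  have e1 : Real.exp (-(ε / β ^ 2) * (a + ε * n))
      * Real.exp (ε / β ^ 2 * a + (ε / β ^ 2) ^ 2 * (β ^ 2 / 2 * n))
      = Real.exp (-(ε ^ 2 / (2 * β ^ 2))) ^ n := by
    rw [← Real.exp_add, ← Real.exp_nat_mul]
    congr 1
    field_simp
    ring
  have e2 : Real.exp (-(-(ε / β ^ 2)) * (a - ε * n))
      * Real.exp (-(ε / β ^ 2) * a + (-(ε / β ^ 2)) ^ 2 * (β ^ 2 / 2 * n))
      = Real.exp (-(ε ^ 2 / (2 * β ^ 2))) ^ n := by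
    rw [← Real.exp_add, ← Real.exp_nat_mul]
    congr 1
    field_simp
    ring
  have hsub : {g | ε * n ≤ |X g - a|} ⊆ {g | a + ε * n ≤ X g} ∪ {g | X g ≤ a - ε * n} := by
    intro g hg
    rcases le_abs.1 (show ε * n ≤ |X g - a| from hg) with h | h
    · exact Or.inl (show a + ε * n ≤ X g by linarith)
    · exact Or.inr (show X g ≤ a - ε * n by linarith)
  calc _ ≤ (gaussianPi (Fin n × Fin n)).real ({g | a + ε * n ≤ X g} ∪ {g | X g ≤ a - ε * n}) :=
        measureReal_mono hsub
    _ ≤ _ := measureReal_union_le _ _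
    _ ≤ _ := by linarith

/-- The free energy per spin of the SK model concentrates around its mean, almost surely. -/
lemma ae_tendsto_freeEnergy_sub {β : ℝ} (hβ : 0 < β) {Ω : Type*} [MeasurableSpace Ω]
    {P : Measure Ω} [IsProbabilityMeasure P] {g : (n : ℕ) → Ω → Fin n × Fin n → ℝ}
    (hg : ∀ n, HasLaw (g n) (gaussianPi (Fin n × Fin n)) P) :
    ∀ᵐ ω ∂P, Tendsto (fun n : ℕ => 1 / (n : ℝ) * (freeEnergy β n (g n ω) - meanFreeEnergy β n))
      atTop (𝓝 0) := by
  -- Borel–Cantelli along the countable family of thresholds `1 / (j + 1)`. Summability involves the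
  -- law of each `g n` separately, never their joint law.
  have bc : ∀ j : ℕ, ∀ᵐ ω ∂P, ∀ᶠ n : ℕ in atTop,
      ω ∉ g n ⁻¹' {x | 1 / ((j : ℝ) + 1) * n ≤ |freeEnergy β n x - meanFreeEnergy β n|} := by
    intro j
    have hj : 0 < 1 / ((j : ℝ) + 1) := by positivity
    refine ae_eventually_notMem ?_
    set r := Real.exp (-((1 / ((j : ℝ) + 1)) ^ 2 / (2 * β ^ 2)))
    have hr : r < 1 := Real.exp_lt_one_iff.2 (neg_lt_zero.2 (by positivity))
    have hs : Summable fun n : ℕ => 2 * r ^ n :=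
      (summable_geometric_of_lt_one (Real.exp_pos _).le hr).mul_left 2
    refine ne_top_of_le_ne_top hs.tsum_ofReal_ne_top (ENNReal.tsum_le_tsum fun n => ?_)
    have hmeas : MeasurableSet
        {x | 1 / ((j : ℝ) + 1) * n ≤ |freeEnergy β n x - meanFreeEnergy β n|} :=
      (isClosed_le continuous_const
        (((continuous_freeEnergy β n).sub continuous_const).abs)).measurableSet
    rw [← Measure.map_apply_of_aemeasurable (hg n).aemeasurable hmeas, (hg n).map_eq,
      ← ofReal_measureReal]
    exact ENNReal.ofReal_le_ofReal (freeEnergy_deviation hβ n hj)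
  filter_upwards [ae_all_iff.2 bc] with ω hω
  -- The strict form gives `n > N`, hence `n > 0`, which the division by `n` needs.
  rw [Metric.tendsto_atTop']
  intro ε hε
  obtain ⟨j, hj⟩ := exists_nat_one_div_lt hε
  obtain ⟨N, hN⟩ := eventually_atTop.1 (hω j)
  refine ⟨N, fun n hn => ?_⟩
  have hn0 : (0 : ℝ) < n := by exact_mod_cast (Nat.zero_le N).trans_lt hn
  have h1 : |freeEnergy β n (g n ω) - meanFreeEnergy β n| < 1 / ((j : ℝ) + 1) * n :=
    not_le.1 (hN n hn.le)
  rw [dist_zero_right, Real.norm_eq_abs, abs_mul, abs_of_pos (by positivity), one_div,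
    inv_mul_lt_iff₀ hn0]
  nlinarith

/-- Existence of the limit of the mean free energy per spin. -/
lemma exists_tendsto_meanFreeEnergy (β : ℝ) :
    ∃ φ : ℝ, Tendsto (fun n : ℕ => 1 / (n : ℝ) * meanFreeEnergy β n) atTop (𝓝 φ) := by
  have hsub : Subadditive fun n => -meanFreeEnergy β n := fun a b => by
    linarith [meanFreeEnergy_add_le β a b]
  -- Fekete's lemma needs a linear bound on the mean free energy; Guerra's bound at any parameters
  -- provides one, and `k = 0`, `q_0 = 0` is the simplest choice.
  let p : RSBParams 0 := ⟨fun _ => 0, fun i => i.elim0, fun _ _ _ => le_rfl,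
    fun _ => ⟨le_rfl, zero_le_one⟩, fun i => i.elim0, fun i => i.elim0⟩
  have hb : BddBelow (Set.range fun n : ℕ => -meanFreeEnergy β n / n) := by
    refine ⟨-|rsbFunctional β p|, ?_⟩
    rintro _ ⟨n, rfl⟩
    rcases Nat.eq_zero_or_pos n with rfl | hn
    · simp
    · have hn' : (0 : ℝ) < n := by exact_mod_cast hn
      beta_reduce
      rw [le_div_iff₀ hn']
      nlinarith [meanFreeEnergy_le β n p, le_abs_self (rsbFunctional β p)]
  refine ⟨-hsub.lim, (hsub.tendsto_lim hb).neg.congr fun n => ?_⟩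
  ring

end Limit

end SK

/-! ### The theorem -/

theorem mainTheorem1 (β : ℝ) (hβ : 0 < β) :
    ∃ φ : ℝ,
      (∀ (Ω : Type u) [MeasurableSpace Ω] (P : Measure Ω) [IsProbabilityMeasure P]
        (G : (n : ℕ) → Ω → Matrix (Fin n) (Fin n) ℝ),
        (∀ (n : ℕ) (i j : Fin n), HasLaw (fun ω => G n ω i j) (gaussianReal 0 1) P) →
        (∀ n : ℕ, iIndepFun (fun (e : Fin n × Fin n) (ω : Ω) => G n ω e.1 e.2) P) →
        ∀ᵐ ω ∂P, Tendsto (fun n : ℕ => 1 / (n : ℝ) * Real.log (SK.partition β (SK.goe (G n ω))))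
          atTop (𝓝 φ)) ∧
      (φ : EReal) ≤ ⨅ (k : ℕ) (p : SK.RSBParams k), ((SK.rsbFunctional β p : ℝ) : EReal) := by
  -- The constant is the limit of the means, so it depends neither on the probability space nor on
  -- the coupling of the `G n`.
  obtain ⟨φ, hφ⟩ := SK.exists_tendsto_meanFreeEnergy β
  refine ⟨φ, fun Ω _ P _ G hlaw hindep => ?_, le_iInf fun k => le_iInf fun p => ?_⟩
  · have hg : ∀ n, HasLaw (fun ω (e : Fin n × Fin n) => G n ω e.1 e.2)
        (SK.gaussianPi (Fin n × Fin n)) P := fun n => by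
      have hm : ∀ e : Fin n × Fin n, AEMeasurable (fun ω => G n ω e.1 e.2) P :=
        fun e => (hlaw n e.1 e.2).aemeasurable
      refine ⟨aemeasurable_pi_lambda _ hm, ?_⟩
      rw [(iIndepFun_iff_map_fun_eq_pi_map hm).1 (hindep n)]
      congr 1
      ext1 e
      exact (hlaw n e.1 e.2).map_eq
    filter_upwards [SK.ae_tendsto_freeEnergy_sub hβ hg] with ω hω
    have := hω.add hφ
    rw [zero_add] at this
    refine this.congr fun n => ?_
    rw [SK.log_partition]
    ring
  · rw [EReal.coe_le_coe_iff]
    refine le_of_tendsto hφ ?_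
    filter_upwards [eventually_gt_atTop 0] with n hn
    have hn' : (0 : ℝ) < n := by exact_mod_cast hn
    rw [one_div, inv_mul_le_iff₀ hn']
    exact SK.meanFreeEnergy_le β n p
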